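/- Let $n>d>0$ and let $v_1,\dots,v_n\in\mathbb R^d$ satisfy $v_i\neq\pm v_j$ for $i\ne j$ (for instance, pairwise non-colinear vectors). An $n\to d$ tile is a translate of a non-degenerate parallelotope generated by $d$ of the $v_i$. An $n\to d$ tiling is a covering of $\mathbb R^d$ by such tiles in which any two distinct tiles are disjoint or intersect in a full common face of dimension less than $d$. A lift of such a tiling maps its vertices to $\mathbb Z^n$ so that each tile generated by $v_{i_1},\dots,v_{i_d}$ is mapped onto a face of a unit hypercube of $\mathbb Z^n$ generated by the canonical basis vectors $e_{i_1},\dots,e_{i_d}$ (each edge $v_i$ being mapped to an edge $e_i$). For a $d$-dimensional subspace $V\subset\mathbb R^n$ and a positive integer $w$, the tiling is planar of slope $V$ and width at most $w$ if it has a lift contained in $V+[0,w)^n$; it is planar of slope $V$ if this holds for some $w$. A planar $n\to d$ tiling of slope $V$ admits local rules if there are a finite set of colors for the tiles and a finite list of allowed ways (up to translation) in which two distinct colored tiles may intersect, such that the colored $n\to d$ tilings all of whose pairs of intersecting tiles are allowed form a non-empty set of planar tilings of slope $V$ and uniformly bounded width. Then: if a planar $n\to d$ tiling of slope $V$ admits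 local rules, it is computable, that is, $V$ has a basis of vectors all of whose coordinates are computable real numbers (numbers that a Turing machine can approximate to within any prescribed precision). -/

import Mathlib

namespace PlanarTiling

/-- The cell with origin `x` spanned by the vectors `v i`, `i ∈ I`: all points
`x + ∑ i ∈ I, s i • v i` with coefficients `s i ∈ [0, 1]`. -/
def cell {m n : ℕ} (v : Fin n → Fin m → ℝ) (x : Fin m → ℝ) (I : Finset (Fin n)) :
    Set (Fin m → ℝ) :=
  {p | ∃ s : Fin n → ℝ, (∀ i ∈ I, 0 ≤ s i ∧ s i ≤ 1) ∧ p = x + ∑ i ∈ I, s i • v i}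

/-- A placed tile: its origin in `ℝ^d` and the set of indices of the vectors that generate it. -/
structure Tile (n d : ℕ) where
  base : Fin d → ℝ
  idx : Finset (Fin n)

/-- The region of `ℝ^d` covered by a tile. -/
def Tile.carrier {n d : ℕ} (v : Fin n → Fin d → ℝ) (t : Tile n d) : Set (Fin d → ℝ) :=
  cell v t.base t.idx

/-- `t` is a (non-degenerate) `n → d` tile: a parallelotope generated by `d` of the vectors. -/
def Tile.IsValid {n d : ℕ} (v : Fin n → Fin d → ℝ) (t : Tile n d) : Prop :=
  t.idx.card = d ∧ LinearIndepOn ℝ v (t.idx : Set (Fin n))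

/-- The faces of dimension less than `d` of a tile: the cells spanned by a proper subset `J` of its
generating vectors, based at a vertex `base + ∑ i ∈ K, v i` with `K` disjoint from `J`. -/
def Tile.IsProperFace {n d : ℕ} (v : Fin n → Fin d → ℝ) (t : Tile n d)
    (F : Set (Fin d → ℝ)) : Prop :=
  ∃ J K : Finset (Fin n), J ⊂ t.idx ∧ K ⊆ t.idx \ J ∧ F = cell v (t.base + ∑ i ∈ K, v i) J

/-- A set of tiles is an `n → d` tiling if it covers `ℝ^d` and any two distinct tiles are disjoint
or intersect in a full common face of dimension less than `d`. -/
structure IsTiling {n d : ℕ} (v : Fin n → Fin d → ℝ) (T : Set (Tile n d)) : Prop where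
  valid : ∀ t ∈ T, t.IsValid v
  covers : ∀ p : Fin d → ℝ, ∃ t ∈ T, p ∈ t.carrier v
  face_to_face : ∀ s ∈ T, ∀ t ∈ T, s ≠ t → (s.carrier v ∩ t.carrier v).Nonempty →
    s.IsProperFace v (s.carrier v ∩ t.carrier v) ∧ t.IsProperFace v (s.carrier v ∩ t.carrier v)

/-- `φ`, a map from points of `ℝ^d` to `ℤ^n` of which only the values at the vertices of the tiling
matter, is a lift of the tiling `T`: every tile generated by the `v i`, `i ∈ I`, is mapped onto the
face of a unit hypercube of `ℤ^n` generated by the canonical basis vectors `e i`, `i ∈ I`. Tiles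
that share vertices are lifted consistently, because `φ` is a function of the vertex. -/
def IsLift {n d : ℕ} (v : Fin n → Fin d → ℝ) (T : Set (Tile n d))
    (φ : (Fin d → ℝ) → (Fin n → ℤ)) : Prop :=
  ∀ t ∈ T, ∀ K ⊆ t.idx,
    φ (t.base + ∑ i ∈ K, v i) = φ t.base + ∑ i ∈ K, Pi.single i (1 : ℤ)

/-- The lifted surface in `ℝ^n`: the union of the lifted tiles. -/
def liftSurface {n d : ℕ} (T : Set (Tile n d)) (φ : (Fin d → ℝ) → (Fin n → ℤ)) :
    Set (Fin n → ℝ) :=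
  {p | ∃ t ∈ T, p ∈ cell (fun i => Pi.single i (1 : ℝ)) (fun i => (φ t.base i : ℝ)) t.idx}

/-- The slice `V + [0, w)^n`. -/
def slice {n : ℕ} (V : Submodule ℝ (Fin n → ℝ)) (w : ℕ) : Set (Fin n → ℝ) :=
  {p | ∃ y ∈ V, ∃ u : Fin n → ℝ, (∀ i, 0 ≤ u i ∧ u i < w) ∧ p = y + u}

/-- `T` is a planar `n → d` tiling of slope `V` and of width at most `w`: it is an `n → d` tiling
that can be lifted into the slice `V + [0, w)^n`. (Slices grow with `w`.) -/
structure IsPlanarOfWidthLE {n d : ℕ} (v : Fin n → Fin d → ℝ) (T : Set (Tile n d))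
    (V : Submodule ℝ (Fin n → ℝ)) (w : ℕ) : Prop where
  tiling : IsTiling v T
  finrank_eq : Module.finrank ℝ V = d
  lifts : ∃ φ : (Fin d → ℝ) → (Fin n → ℤ), IsLift v T φ ∧ liftSurface T φ ⊆ slice V w

/-- `T` is a planar `n → d` tiling of slope `V`. -/
def IsPlanar {n d : ℕ} (v : Fin n → Fin d → ℝ) (T : Set (Tile n d))
    (V : Submodule ℝ (Fin n → ℝ)) : Prop :=
  ∃ w : ℕ, 0 < w ∧ IsPlanarOfWidthLE v T V w

/-- A colored tile type: the generating vectors and one of `k` colors. -/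
abbrev ColoredType (n k : ℕ) := Finset (Fin n) × Fin k

/-- A rule `(p, q, z)` allows a tile of colored type `q` to meet a tile of colored type `p` when its
origin is that of the latter translated by `z`. -/
abbrev Rule (n d k : ℕ) := ColoredType n k × ColoredType n k × (Fin d → ℝ)

/-- The tiling `T`, in which the tile `t` has color `c t`, is allowed by the set of rules `R`: any
two distinct tiles that intersect do so in a way listed in `R`. -/
structure IsAllowed {n d k : ℕ} (v : Fin n → Fin d → ℝ) (R : Set (Rule n d k))
    (T : Set (Tile n d)) (c : Tile n d → Fin k) : Prop where
  tiling : IsTiling v T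
  rules : ∀ s ∈ T, ∀ t ∈ T, s ≠ t → (s.carrier v ∩ t.carrier v).Nonempty →
    ((s.idx, c s), (t.idx, c t), t.base - s.base) ∈ R

/-- The slope `V` admits local rules: for some finite number `k` of colors and some finite set of
rules, the allowed colored tilings form a non-empty set of planar tilings of slope `V` and of
uniformly bounded width. -/
def AdmitsLocalRules {n d : ℕ} (v : Fin n → Fin d → ℝ) (V : Submodule ℝ (Fin n → ℝ)) : Prop :=
  ∃ (k : ℕ) (R : Set (Rule n d k)), R.Finite ∧
    (∃ T c, IsAllowed v R T c) ∧
    ∃ w : ℕ, 0 < w ∧ ∀ T c, IsAllowed v R T c → IsPlanarOfWidthLE v T V w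

/-- A real number is computable if some computable (Turing-computable) function gives, on input `k`,
the numerator of a dyadic approximation of it to within `2⁻ᵏ`. -/
def IsComputableReal (x : ℝ) : Prop :=
  ∃ f : ℕ → ℤ, Computable f ∧ ∀ k : ℕ, |x - (f k : ℝ) / 2 ^ k| ≤ 1 / 2 ^ k

/-- A subspace of `ℝ^n` is computable if it has a basis of vectors with computable coordinates. -/
def IsComputableSubspace {n : ℕ} (V : Submodule ℝ (Fin n → ℝ)) : Prop :=
  ∃ b : Module.Basis (Fin (Module.finrank ℝ V)) ℝ V,
    ∀ i j, IsComputableReal ((b i : Fin n → ℝ) j)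

end PlanarTiling

namespace PlanarTiling

/-! Allowed tilings are encoded as configurations on `ℤ^d` governed by a finite table of local
constraints. The site `g` follows the point `δ g` and carries an integer height, the lift of the
origin of a tile, together with the patch of lifted colored tiles around it. An allowed planar
tiling yields a configuration (`IsAllowed.exists_isConfig`). Conversely, the patches of any
configuration glue to an allowed tiling (`IsConfig.exists_isAllowed`), and every lift of it agrees
with the heights up to a translation (`IsConfig.lift_eq`). The local rules therefore keep the
heights of all configurations within one fixed distance of `V`. Real numbers enter only in selecting
the finite table, which can be hard-wired into a program.

Since `V` is a graph over `d` of the coordinates, it suffices to compute the coefficients `β` that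
express each coordinate through these. The heights at the sites `R 2^k e_l` have size `O(2^k)`, are
close to `V`, and are uniformly independent because their projections to `ℝ^d` stay near `δ R 2^k
e_l`. Hence rational coefficients within `O(2^-k)` of `β` satisfy the equation of the graph at these
heights up to a bounded error, and conversely a bounded error at these heights forces the
coefficients to be within `O(2^-k)` of `β` (`exists_uniform_independence`).

The program does not know `V`. It searches for numerators `B` and a depth `m` such that every
partial configuration on the first `m` sites visits the test sites and passes the test. The rounding
of `β` passes for all full configurations, so by König's lemma (`exists_infinite_branch`) some
finite depth works and the search halts. Whatever it returns passes on an actual configuration, and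
one exists, so it approximates `β`. -/

/-! ### Primitive recursive integer arithmetic -/

theorem primrec_int_toNat : Primrec Int.toNat := by
  -- The encoding of `ℤ` sends `m` to `2 * m` and `-(m + 1)` to `2 * m + 1`, so parity is the sign.
  have h : Primrec fun z : ℤ =>
      bif (Encodable.encode z).bodd then 0 else (Encodable.encode z).div2 :=
    Primrec.cond (Primrec.nat_bodd.comp Primrec.encode) (Primrec.const 0)
      (Primrec.nat_div2.comp Primrec.encode)
  refine h.of_eq fun z => ?_
  cases z with
  | ofNat m =>
    have : Encodable.encode (Int.ofNat m) = 2 * m := rfl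
    rw [this]; simp
  | negSucc m =>
    have : Encodable.encode (Int.negSucc m) = 2 * m + 1 := rfl
    rw [this]; simp

theorem primrec_int_subNatNat : Primrec₂ Int.subNatNat := by
  have h : Primrec₂ fun a b : ℕ =>
      Denumerable.ofNat ℤ (if b ≤ a then 2 * (a - b) else 2 * (b - a - 1) + 1) := by
    refine (Primrec.ofNat ℤ).comp ?_
    refine Primrec.ite (Primrec.nat_le.comp Primrec.snd Primrec.fst) ?_ ?_
    · exact Primrec.nat_mul.comp (Primrec.const 2)
        (Primrec.nat_sub.comp Primrec.fst Primrec.snd)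
    · exact Primrec.succ.comp (Primrec.nat_mul.comp (Primrec.const 2)
        (Primrec.nat_sub.comp (Primrec.nat_sub.comp Primrec.snd Primrec.fst) (Primrec.const 1)))
  refine h.of_eq fun a b => ?_
  apply Encodable.encode_injective
  rw [Denumerable.encode_ofNat]
  split_ifs with hab
  · rw [Int.subNatNat_of_le hab]; rfl
  · rw [Int.subNatNat_of_lt (by omega)]
    rfl

theorem primrec_int_neg_toNat : Primrec fun z : ℤ => (-z).toNat := by
  have h : Primrec fun z : ℤ =>
      bif (Encodable.encode z).bodd then (Encodable.encode z).div2 + 1 else 0 :=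
    Primrec.cond (Primrec.nat_bodd.comp Primrec.encode)
      (Primrec.succ.comp (Primrec.nat_div2.comp Primrec.encode)) (Primrec.const 0)
  refine h.of_eq fun z => ?_
  cases z with
  | ofNat m =>
    have : Encodable.encode (Int.ofNat m) = 2 * m := rfl
    rw [this]; simp
  | negSucc m =>
    have : Encodable.encode (Int.negSucc m) = 2 * m + 1 := rfl
    rw [this]; simp

theorem primrec_int_natAbs : Primrec Int.natAbs :=
  (Primrec.nat_add.comp primrec_int_toNat primrec_int_neg_toNat).of_eq fun z => by omega

theorem primrec_int_add : Primrec₂ fun a b : ℤ => a + b := by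
  have h := primrec_int_subNatNat.comp₂
    (Primrec.nat_add.comp₂ (primrec_int_toNat.comp₂ Primrec₂.left)
      (primrec_int_toNat.comp₂ Primrec₂.right))
    (Primrec.nat_add.comp₂ (primrec_int_neg_toNat.comp₂ Primrec₂.left)
      (primrec_int_neg_toNat.comp₂ Primrec₂.right))
  refine h.of_eq fun a b => ?_
  rw [Int.subNatNat_eq_coe]
  push_cast
  omega

theorem primrec_int_sub : Primrec₂ fun a b : ℤ => a - b := by
  have h := primrec_int_subNatNat.comp₂
    (Primrec.nat_add.comp₂ (primrec_int_toNat.comp₂ Primrec₂.left)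
      (primrec_int_neg_toNat.comp₂ Primrec₂.right))
    (Primrec.nat_add.comp₂ (primrec_int_neg_toNat.comp₂ Primrec₂.left)
      (primrec_int_toNat.comp₂ Primrec₂.right))
  refine h.of_eq fun a b => ?_
  rw [Int.subNatNat_eq_coe]
  push_cast
  omega

theorem primrec_int_mul : Primrec₂ fun a b : ℤ => a * b := by
  have h := primrec_int_subNatNat.comp₂
    (Primrec.nat_add.comp₂
      (Primrec.nat_mul.comp₂ (primrec_int_toNat.comp₂ Primrec₂.left)
        (primrec_int_toNat.comp₂ Primrec₂.right))
      (Primrec.nat_mul.comp₂ (primrec_int_neg_toNat.comp₂ Primrec₂.left)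
        (primrec_int_neg_toNat.comp₂ Primrec₂.right)))
    (Primrec.nat_add.comp₂
      (Primrec.nat_mul.comp₂ (primrec_int_toNat.comp₂ Primrec₂.left)
        (primrec_int_neg_toNat.comp₂ Primrec₂.right))
      (Primrec.nat_mul.comp₂ (primrec_int_neg_toNat.comp₂ Primrec₂.left)
        (primrec_int_toNat.comp₂ Primrec₂.right)))
  refine h.of_eq fun a b => ?_
  rw [Int.subNatNat_eq_coe]
  have ha : a = (a.toNat : ℤ) - ((-a).toNat : ℤ) := by omega
  have hb : b = (b.toNat : ℤ) - ((-b).toNat : ℤ) := by omega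
  conv_rhs => rw [ha, hb]
  push_cast
  ring

theorem primrec_int_natCast : Primrec fun m : ℕ => (m : ℤ) :=
  (primrec_int_subNatNat.comp Primrec.id (Primrec.const 0)).of_eq fun m => by
    rw [Int.subNatNat_eq_coe]; simp

theorem primrec_int_div_nat {c : ℕ} (hc : 0 < c) : Primrec fun z : ℤ => z / (c : ℤ) := by
  -- For `z = -m` the floor quotient is minus the ceiling of `m / c`, that is `-((m + (c - 1)) /
  -- c)`; for `z ≥ 0` this second term is `(c - 1) / c = 0`.
  have h := primrec_int_sub.comp
    (primrec_int_natCast.comp (Primrec.nat_div.comp primrec_int_toNat (Primrec.const c)))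
    (primrec_int_natCast.comp (Primrec.nat_div.comp
      (Primrec.nat_add.comp primrec_int_neg_toNat (Primrec.const (c - 1))) (Primrec.const c)))
  refine h.of_eq fun z => ?_
  rcases le_or_gt 0 z with hz | hz
  · have h1 : (-z).toNat = 0 := by omega
    have h2 : (c - 1) / c = 0 := Nat.div_eq_of_lt (by omega)
    obtain ⟨m, rfl⟩ := Int.eq_ofNat_of_zero_le hz
    simp [h1, h2]
  · obtain ⟨m, rfl⟩ : ∃ m : ℕ, z = -(m : ℤ) := ⟨z.natAbs, by omega⟩
    have h1 : (-(m : ℤ)).toNat = 0 := by omega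
    have h2 : (- -(m : ℤ)).toNat = m := by omega
    rw [h1, h2]
    have h3 : -(m : ℤ) / (c : ℤ) = -((m + (c - 1) : ℕ) / c : ℕ) := by
      symm
      rw [eq_comm, Int.ediv_eq_iff_of_pos (by omega)]
      have h4 := Nat.div_mul_le_self (m + (c - 1)) c
      have h5 := Nat.lt_div_mul_add (a := m + (c - 1)) hc
      zify [Nat.one_le_iff_ne_zero.2 hc.ne'] at h4 h5 ⊢
      constructor <;> nlinarith
    rw [h3]; simp

theorem primrec_fun_sub (n : ℕ) : Primrec₂ fun a b : Fin n → ℤ => a - b := by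
  refine Primrec.fin_curry.2 ?_
  exact primrec_int_sub.comp₂
    (Primrec.fin_app.comp₂ (Primrec.fst.comp₂ Primrec₂.left) Primrec₂.right)
    (Primrec.fin_app.comp₂ (Primrec.snd.comp₂ Primrec₂.left) Primrec₂.right)

theorem primrec_fun_add (n : ℕ) : Primrec₂ fun a b : Fin n → ℤ => a + b := by
  refine Primrec.fin_curry.2 ?_
  exact primrec_int_add.comp₂
    (Primrec.fin_app.comp₂ (Primrec.fst.comp₂ Primrec₂.left) Primrec₂.right)
    (Primrec.fin_app.comp₂ (Primrec.snd.comp₂ Primrec₂.left) Primrec₂.right)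

theorem primrec_finset_sum_nat {α ι : Type*} [Primcodable α] (s : Finset ι) {f : ι → α → ℕ}
    (hf : ∀ i, Primrec (f i)) : Primrec fun a => ∑ i ∈ s, f i a := by
  classical
  induction s using Finset.induction_on with
  | empty => simpa using Primrec.const 0
  | insert i s hi ih =>
    simp only [Finset.sum_insert hi]
    exact Primrec.nat_add.comp (hf i) ih

theorem primrec_finset_sum_int {α ι : Type*} [Primcodable α] (s : Finset ι) {f : ι → α → ℤ}
    (hf : ∀ i, Primrec (f i)) : Primrec fun a => ∑ i ∈ s, f i a := by
  classical
  induction s using Finset.induction_on with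
  | empty => simpa using Primrec.const 0
  | insert i s hi ih =>
    simp only [Finset.sum_insert hi]
    exact primrec_int_add.comp (hf i) ih

/-- A finite set can be listed inside the program, however non-constructively it was obtained. -/
theorem primrecPred_mem_finite {α : Type*} [Primcodable α] {s : Set α} (hs : s.Finite) :
    PrimrecPred fun a => a ∈ s := by
  have h : PrimrecRel fun (L : List α) (a : α) => ∃ b ∈ L, b = a :=
    PrimrecRel.exists_mem_list Primrec.eq
  refine (h.comp (Primrec.const hs.toFinset.toList) Primrec.id).of_eq fun a => by simp

theorem primrecPred_forall_fin {α : Type*} [Primcodable α] {N : ℕ} {p : Fin N → α → Prop}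
    (hp : ∀ i, PrimrecPred (p i)) : PrimrecPred fun a => ∀ i, p i a := by
  have key : ∀ s : Finset (Fin N), PrimrecPred fun a => ∀ i ∈ s, p i a := by
    intro s
    induction s using Finset.induction_on with
    | empty => exact ((Primrec.eq (α := ℕ)).comp (Primrec.const 0) (Primrec.const 0)).of_eq (by simp)
    | insert i s hi ih => exact ((hp i).and ih).of_eq fun a => by simp
  exact (key Finset.univ).of_eq fun a => by simp

/-! ### Finitely branching trees and unbounded search -/

/-- The list of the sequences of length `m` that grow from the empty list, where `next ℓ` lists the
possible continuations of `ℓ`. -/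
def branches {Y : Type*} (next : List Y → List Y) : ℕ → List (List Y)
  | 0 => [[]]
  | m + 1 => (branches next m).flatMap fun l => (next l).map fun y => l ++ [y]

theorem primrec_branches {Y : Type*} [Primcodable Y] {next : List Y → List Y}
    (h : Primrec next) : Primrec (branches next) := by
  have step : Primrec₂ fun (_ : ℕ) (L : List (List Y)) =>
      L.flatMap fun l => (next l).map fun y => l ++ [y] := by
    refine Primrec.list_flatMap Primrec.snd ?_
    refine Primrec.list_map (h.comp Primrec.snd) ?_
    exact Primrec.list_concat.comp₂ (Primrec.snd.comp₂ Primrec₂.left) Primrec₂.right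
  refine (Primrec.nat_rec₁ [[]] step).of_eq fun m => ?_
  induction m with
  | zero => rfl
  | succ m ih => simp only [branches, ← ih]

section branches

variable {Y : Type*} {next : List Y → List Y}

theorem mem_branches_succ {m : ℕ} {l : List Y} :
    l ∈ branches next (m + 1) ↔ ∃ l' ∈ branches next m, ∃ y ∈ next l', l = l' ++ [y] := by
  simp [branches, eq_comm]

theorem length_of_mem_branches {m : ℕ} {l : List Y} (h : l ∈ branches next m) : l.length = m := by
  induction m generalizing l with
  | zero => simpa [branches] using h
  | succ m ih =>
    obtain ⟨l', h', y, -, rfl⟩ := mem_branches_succ.1 h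
    simp [ih h']

theorem take_mem_branches {m j : ℕ} (hj : j ≤ m) {l : List Y} (h : l ∈ branches next m) :
    l.take j ∈ branches next j := by
  induction m generalizing l with
  | zero =>
    obtain rfl : j = 0 := by omega
    simp [branches]
  | succ m ih =>
    rcases Nat.lt_or_ge m j with hlt | hle
    · obtain rfl : j = m + 1 := by omega
      rwa [List.take_of_length_le (length_of_mem_branches h).le]
    · obtain ⟨l', h', y, -, rfl⟩ := mem_branches_succ.1 h
      rw [List.take_append_of_le_length (by rw [length_of_mem_branches h']; exact hle)]
      exact ih hle h'

theorem map_range_mem_branches {c : ℕ → Y} (hc : ∀ m, c m ∈ next ((List.range m).map c)) (m : ℕ) :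
    (List.range m).map c ∈ branches next m := by
  induction m with
  | zero => simp [branches]
  | succ m ih =>
    exact mem_branches_succ.2 ⟨_, ih, _, hc m, by simp [List.range_succ]⟩

/-- König's lemma. As `Q` persists under extension, truncation preserves its failure, so the
branches where `Q` fails form an inverse system of finite non-empty sets. -/
theorem exists_infinite_branch {Q : List Y → Prop} (hQ : ∀ l y, Q l → Q (l ++ [y]))
    (h : ∀ m, ∃ l ∈ branches next m, ¬ Q l) :
    ∃ c : ℕ → Y, (∀ m, c m ∈ next ((List.range m).map c)) ∧
      ∀ m, ¬ Q ((List.range m).map c) := by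
  classical
  have hQt : ∀ l l', Q l → Q (l ++ l') := by
    intro l l'
    induction l' using List.reverseRecOn with
    | nil => simp
    | append_singleton l' y ih => intro hl; rw [← List.append_assoc]; exact hQ _ _ (ih hl)
  let α : ℕ → Type _ := fun m => {l : List Y // l ∈ branches next m ∧ ¬ Q l}
  have fin : ∀ m, Finite (α m) := fun m =>
    Set.Finite.subset (List.finite_toSet (branches next m)) fun l hl => hl.1
  have : ∀ m, Nonempty (α m) := fun m => by
    obtain ⟨l, hl, hl'⟩ := h m
    exact ⟨⟨l, hl, hl'⟩⟩
  let π : {i j : ℕ} → i ≤ j → α j → α i := fun {i j} hij l =>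
    ⟨l.1.take i, take_mem_branches hij l.2.1, fun hl => l.2.2 (by
      have := hQt _ (l.1.drop i) hl
      rwa [List.take_append_drop] at this)⟩
  have := fin 0
  obtain ⟨f, hf⟩ := exists_seq_forall_proj_of_forall_finite (α := α) π
    (fun i a => Subtype.ext (List.take_of_length_le (length_of_mem_branches a.2.1).le))
    (fun i j k hij hjk a => Subtype.ext (by simp [π, List.take_take, hij]))
    (fun i a => by have := fin (i + 1); exact Set.toFinite _)
  have step : ∀ i, ∃ y ∈ next (f i).1, (f (i + 1)).1 = (f i).1 ++ [y] := by
    intro i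
    obtain ⟨l', h', y, hy, heq⟩ := mem_branches_succ.1 (f (i + 1)).2.1
    have h1 : (f (i + 1)).1.take i = (f i).1 := congrArg Subtype.val (hf (Nat.le_succ i))
    rw [heq, List.take_append_of_le_length (length_of_mem_branches h').ge,
      List.take_of_length_le (length_of_mem_branches h').le] at h1
    subst h1
    exact ⟨y, hy, heq⟩
  choose c hc hc' using step
  have hpre : ∀ m, (List.range m).map c = (f m).1 := by
    intro m
    induction m with
    | zero =>
      have := length_of_mem_branches (f 0).2.1
      simp [List.length_eq_zero_iff.1 this]
    | succ m ih => rw [List.range_succ, List.map_append, ih, hc' m]; rfl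
  exact ⟨c, fun m => by rw [hpre]; exact hc m, fun m => by rw [hpre]; exact (f m).2.2⟩

end branches

/-- Testing the codes of `β` one after the other halts, because a witness exists. -/
theorem exists_computable_choice {α β : Type*} [Primcodable α] [Primcodable β]
    {P : α → β → Prop} (hP : PrimrecRel P) (h : ∀ a, ∃ b, P a b) :
    ∃ f : α → β, Computable f ∧ ∀ a, P a (f a) := by
  classical
  let F : α → ℕ → Option β := fun a j =>
    (Encodable.decode (α := β) j).bind fun b => if P a b then some b else none
  have hF : Computable₂ F := by
    refine Primrec.to_comp ?_
    refine Primrec.option_bind (Primrec.decode.comp Primrec.snd) ?_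
    refine Primrec.ite (hP.comp (Primrec.fst.comp Primrec.fst) Primrec.snd)
      (Primrec.option_some.comp Primrec.snd) (Primrec.const none)
  have hdom : ∀ a, (Nat.rfindOpt (F a)).Dom := by
    intro a
    obtain ⟨b, hb⟩ := h a
    exact Nat.rfindOpt_dom.2 ⟨Encodable.encode b, b, by simp [F, hb]⟩
  refine ⟨fun a => (Nat.rfindOpt (F a)).get (hdom a),
    (Partrec.rfindOpt hF).of_eq_tot fun a => Part.get_mem _, fun a => ?_⟩
  obtain ⟨j, hj⟩ := Nat.rfindOpt_spec (Part.get_mem (hdom a))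
  simp only [F, Option.mem_def, Option.bind_eq_some_iff] at hj
  obtain ⟨b, -, hb⟩ := hj
  split_ifs at hb with hb'
  obtain rfl := Option.some.inj hb
  exact hb'

/-! ### Effective enumeration of partial configurations -/

/-- Configurations on `ℤ^d`, made of a height `ψ g ∈ ℤ^n` and a state `s g` at each site `g`, that
satisfy the local constraints `Tab` between sites whose difference is in `K`. -/
def IsConfig {d n : ℕ} {S : Type*} (K : Set (Fin d → ℤ))
    (Tab : Set ((Fin d → ℤ) × (Fin n → ℤ) × S × S)) (ψ : (Fin d → ℤ) → (Fin n → ℤ))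
    (s : (Fin d → ℤ) → S) : Prop :=
  ψ 0 = 0 ∧ ∀ g h, h - g ∈ K → (h - g, ψ h - ψ g, s g, s h) ∈ Tab

/-- The `ℓ¹` norm on `ℤ^d`. -/
def latticeNorm {d : ℕ} (g : Fin d → ℤ) : ℕ := ∑ l, (g l).natAbs

theorem exists_latticeNorm_add_single {d : ℕ} {g : Fin d → ℤ} {m : ℕ}
    (hg : latticeNorm g = m + 1) :
    ∃ l, ∃ ε : ℤ, (ε = 1 ∨ ε = -1) ∧ latticeNorm (g + Pi.single l ε) = m := by
  obtain ⟨l, hl⟩ : ∃ l, g l ≠ 0 := by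
    by_contra! h
    have : latticeNorm g = 0 := by simp [latticeNorm, h]
    omega
  have key : ∀ ε : ℤ, (g l + ε).natAbs + 1 = (g l).natAbs →
      latticeNorm (g + Pi.single l ε) = m := by
    intro ε hε
    unfold latticeNorm at hg ⊢
    rw [← Finset.add_sum_erase _ _ (Finset.mem_univ l)] at hg ⊢
    have : ∑ x ∈ Finset.univ.erase l, ((g + Pi.single l ε : Fin d → ℤ) x).natAbs =
        ∑ x ∈ Finset.univ.erase l, (g x).natAbs := by
      refine Finset.sum_congr rfl fun x hx => ?_
      simp [Pi.single_eq_of_ne (Finset.ne_of_mem_erase hx)]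
    rw [this]
    simp only [Pi.add_apply, Pi.single_eq_same]
    omega
  rcases lt_or_gt_of_ne hl with h | h
  · exact ⟨l, 1, Or.inl rfl, key _ (by omega)⟩
  · exact ⟨l, -1, Or.inr rfl, key _ (by omega)⟩

/-- The sums of `m` vectors of the list `steps`. -/
def reach {n : ℕ} (steps : List (Fin n → ℤ)) : ℕ → List (Fin n → ℤ)
  | 0 => [0]
  | m + 1 => (reach steps m).flatMap fun x => steps.map fun t => x + t

theorem primrec_reach {n : ℕ} (steps : List (Fin n → ℤ)) : Primrec (reach steps) := by
  have step : Primrec₂ fun (_ : ℕ) (L : List (Fin n → ℤ)) =>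
      L.flatMap fun x => steps.map fun t => x + t := by
    refine Primrec.list_flatMap Primrec.snd ?_
    refine Primrec.list_map (Primrec.const steps) ?_
    exact (primrec_fun_add n).comp₂ (Primrec.snd.comp₂ Primrec₂.left) Primrec₂.right
  refine (Primrec.nat_rec₁ [0] step).of_eq fun m => ?_
  induction m with
  | zero => rfl
  | succ m ih => simp only [reach, ← ih]

section effective

/-- The constraint between two sites, given with their heights and states. -/
def siteRel {d n : ℕ} (K : Set (Fin d → ℤ)) (Tab : Set ((Fin d → ℤ) × (Fin n → ℤ) × ℕ × ℕ))
    (x y : (Fin d → ℤ) × (Fin n → ℤ) × ℕ) : Prop :=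
  -- The last clause handles repetitions in the enumeration of the sites: an index that decodes to
  -- nothing names the site `0`.
  (y.1 - x.1 ∈ K → (y.1 - x.1, y.2.1 - x.2.1, x.2.2, y.2.2) ∈ Tab) ∧ (x.1 = y.1 → x = y)

theorem primrecRel_siteRel {d n : ℕ} {K : Set (Fin d → ℤ)} (hK : K.Finite)
    {Tab : Set ((Fin d → ℤ) × (Fin n → ℤ) × ℕ × ℕ)} (hTab : Tab.Finite) :
    PrimrecRel (siteRel K Tab) := by
  have hg : Primrec₂ fun x y : (Fin d → ℤ) × (Fin n → ℤ) × ℕ => y.1 - x.1 :=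
    (primrec_fun_sub d).comp₂ (Primrec.fst.comp₂ Primrec₂.right) (Primrec.fst.comp₂ Primrec₂.left)
  have hz : Primrec₂ fun x y : (Fin d → ℤ) × (Fin n → ℤ) × ℕ => y.2.1 - x.2.1 :=
    (primrec_fun_sub n).comp₂ ((Primrec.fst.comp Primrec.snd).comp₂ Primrec₂.right)
      ((Primrec.fst.comp Primrec.snd).comp₂ Primrec₂.left)
  have ht : Primrec₂ fun x y : (Fin d → ℤ) × (Fin n → ℤ) × ℕ =>
      (y.1 - x.1, y.2.1 - x.2.1, x.2.2, y.2.2) :=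
    Primrec.pair hg (Primrec.pair hz (Primrec.pair
      (Primrec.snd.comp (Primrec.snd.comp Primrec.fst))
      (Primrec.snd.comp (Primrec.snd.comp Primrec.snd))))
  have h1 := (primrecPred_mem_finite hK).comp hg
  have h2 := (primrecPred_mem_finite hTab).comp ht
  have h3 : PrimrecPred fun p : ((Fin d → ℤ) × (Fin n → ℤ) × ℕ) × ((Fin d → ℤ) × (Fin n → ℤ) × ℕ) =>
      p.1.1 = p.2.1 :=
    Primrec.eq.comp (Primrec.fst.comp Primrec.fst) (Primrec.fst.comp Primrec.snd)
  have h4 : PrimrecPred fun p : ((Fin d → ℤ) × (Fin n → ℤ) × ℕ) × ((Fin d → ℤ) × (Fin n → ℤ) × ℕ) =>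
      p.1 = p.2 := Primrec.eq.comp Primrec.fst Primrec.snd
  refine ((h1.not.or h2).and (h3.not.or h4)).of_eq fun p => ?_
  simp only [siteRel, imp_iff_not_or]

/-- The `m`-th site. -/
def site (d m : ℕ) : Fin d → ℤ :=
  ((@Encodable.decode (Fin d → ℤ) Primcodable.toEncodable m)).getD 0

/-- The index of a site. -/
def siteIndex {d : ℕ} (g : Fin d → ℤ) : ℕ :=
  @Encodable.encode (Fin d → ℤ) Primcodable.toEncodable g

theorem site_siteIndex {d : ℕ} (g : Fin d → ℤ) : site d (siteIndex g) = g := by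
  simp [site, siteIndex]

theorem primrec_site (d : ℕ) : Primrec (site d) :=
  Primrec.option_getD.comp Primrec.decode (Primrec.const 0)

/-- The candidate values at the `m`-th site. -/
def candidates {n : ℕ} (d : ℕ) (steps : List (Fin n → ℤ)) (states : List ℕ) (m : ℕ) :
    List ((Fin d → ℤ) × (Fin n → ℤ) × ℕ) :=
  (reach steps (latticeNorm (site d m))).flatMap fun z => states.map fun s => (site d m, z, s)

theorem primrec_candidates {n : ℕ} (d : ℕ) (steps : List (Fin n → ℤ)) (states : List ℕ) :
    Primrec (candidates d steps states) := by
  have h1 : Primrec fun m => latticeNorm (site d m) :=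
    primrec_finset_sum_nat Finset.univ fun i =>
      primrec_int_natAbs.comp (Primrec.fin_app.comp (primrec_site d) (Primrec.const i))
  refine Primrec.list_flatMap ((primrec_reach steps).comp h1) ?_
  refine Primrec.list_map (Primrec.const states) ?_
  exact Primrec.pair ((primrec_site d).comp (Primrec.fst.comp Primrec.fst))
    (Primrec.pair (Primrec.snd.comp Primrec.fst) Primrec.snd)

open Classical in
/-- The admissible values at the next site, given those at the previous ones. -/
noncomputable def extensions {d n : ℕ} (K : Set (Fin d → ℤ)) (Tab : Set ((Fin d → ℤ) × (Fin n → ℤ) × ℕ × ℕ))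
    (steps : List (Fin n → ℤ)) (states : List ℕ) (l : List ((Fin d → ℤ) × (Fin n → ℤ) × ℕ)) :
    List ((Fin d → ℤ) × (Fin n → ℤ) × ℕ) :=
  (candidates d steps states l.length).filter fun y =>
    siteRel K Tab y y ∧ ∀ x ∈ l, siteRel K Tab x y ∧ siteRel K Tab y x

theorem primrec_extensions {d n : ℕ} {K : Set (Fin d → ℤ)} (hK : K.Finite)
    {Tab : Set ((Fin d → ℤ) × (Fin n → ℤ) × ℕ × ℕ)} (hTab : Tab.Finite)
    (steps : List (Fin n → ℤ)) (states : List ℕ) :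
    Primrec (extensions K Tab steps states) := by
  classical
  have hr := primrecRel_siteRel hK hTab
  have h1 : PrimrecRel fun (x y : (Fin d → ℤ) × (Fin n → ℤ) × ℕ) =>
      siteRel K Tab x y ∧ siteRel K Tab y x :=
    PrimrecPred.and (hr.comp Primrec.fst Primrec.snd) (hr.comp Primrec.snd Primrec.fst)
  have h2 : PrimrecRel fun (y : (Fin d → ℤ) × (Fin n → ℤ) × ℕ)
      (l : List ((Fin d → ℤ) × (Fin n → ℤ) × ℕ)) =>
      siteRel K Tab y y ∧ ∀ x ∈ l, siteRel K Tab x y ∧ siteRel K Tab y x :=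
    PrimrecPred.and (hr.comp Primrec.fst Primrec.fst)
      (h1.forall_mem_list.comp Primrec.snd Primrec.fst)
  exact (h2.listFilter.comp ((primrec_candidates d steps states).comp Primrec.list_length)
    Primrec.id).of_eq fun l => by simp [extensions]

variable {d n : ℕ} {K : Set (Fin d → ℤ)} {Tab : Set ((Fin d → ℤ) × (Fin n → ℤ) × ℕ × ℕ)}
  {steps : List (Fin n → ℤ)} {states : List ℕ}

theorem mem_extensions {l : List ((Fin d → ℤ) × (Fin n → ℤ) × ℕ)}
    {y : (Fin d → ℤ) × (Fin n → ℤ) × ℕ} :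
    y ∈ extensions K Tab steps states l ↔
      (y.1 = site d l.length ∧ y.2.1 ∈ reach steps (latticeNorm (site d l.length)) ∧
        y.2.2 ∈ states) ∧
      siteRel K Tab y y ∧ ∀ x ∈ l, siteRel K Tab x y ∧ siteRel K Tab y x := by
  obtain ⟨g, z, s⟩ := y
  simp only [extensions, candidates, List.mem_filter, List.mem_flatMap, List.mem_map,
    Prod.mk.injEq, decide_eq_true_eq]
  constructor
  · rintro ⟨⟨z', hz', s', hs', rfl, rfl, rfl⟩, h⟩
    exact ⟨⟨rfl, hz', hs'⟩, h⟩
  · rintro ⟨⟨rfl, hz', hs'⟩, h⟩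
    exact ⟨⟨z, hz', s, hs', rfl, rfl, rfl⟩, h⟩

/-- Along a shortest path of unit steps to `0`, where the height is `0`, each change of height is
listed in `Tab` up to sign. This leaves finitely many candidate heights at each site, so the tree of
partial configurations is finitely branching. -/
theorem IsConfig.mem_reach {ψ : (Fin d → ℤ) → (Fin n → ℤ)} {s : (Fin d → ℤ) → ℕ}
    (h : IsConfig K Tab ψ s) (hK : ∀ l, Pi.single l 1 ∈ K)
    (hsteps : ∀ t ∈ Tab, t.2.1 ∈ steps ∧ -t.2.1 ∈ steps) (m : ℕ) (g : Fin d → ℤ)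
    (hg : latticeNorm g = m) : ψ g ∈ reach steps m := by
  induction m generalizing g with
  | zero =>
    have : g = 0 := by
      ext l
      have := (Finset.sum_eq_zero_iff.1 hg) l (Finset.mem_univ l)
      simpa using this
    simp [this, reach, h.1]
  | succ m ih =>
    obtain ⟨l, ε, hε, hl⟩ := exists_latticeNorm_add_single hg
    simp only [reach, List.mem_flatMap, List.mem_map]
    refine ⟨_, ih _ hl, ψ g - ψ (g + Pi.single l ε), ?_, by abel⟩
    rcases hε with rfl | rfl
    · have := (hsteps _ (h.2 g (g + Pi.single l 1) (by simpa using hK l))).2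
      simpa using this
    · have := (hsteps _ (h.2 (g + Pi.single l (-1)) g (by
        have h1 : g - (g + Pi.single l (-1)) = Pi.single l 1 := by
          rw [Pi.single_neg]; abel
        rw [h1]; exact hK l))).1
      simpa using this

theorem IsConfig.mem_extensions {ψ : (Fin d → ℤ) → (Fin n → ℤ)} {s : (Fin d → ℤ) → ℕ}
    (h : IsConfig K Tab ψ s) (hd : 0 < d) (hK : ∀ l, Pi.single l 1 ∈ K)
    (hsteps : ∀ t ∈ Tab, t.2.1 ∈ steps ∧ -t.2.1 ∈ steps) (hstates : ∀ t ∈ Tab, t.2.2.1 ∈ states)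
    (m : ℕ) :
    (site d m, ψ (site d m), s (site d m)) ∈ extensions K Tab steps states
      ((List.range m).map fun i => (site d i, ψ (site d i), s (site d i))) := by
  have hrel : ∀ i j, siteRel K Tab (site d i, ψ (site d i), s (site d i))
      (site d j, ψ (site d j), s (site d j)) := by
    refine fun i j => ⟨fun hij => h.2 _ _ hij, fun hij => ?_⟩
    simp only at hij
    rw [hij]
  refine PlanarTiling.mem_extensions.2 ⟨⟨by simp, ?_, ?_⟩, hrel _ _, ?_⟩
  · simpa using h.mem_reach hK hsteps _ _ rfl
  · have h1 := hstates _ (h.2 (site d m) (site d m + Pi.single ⟨0, hd⟩ 1)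
      (by simpa using hK _))
    exact h1
  · intro x hx
    obtain ⟨i, -, rfl⟩ := List.mem_map.1 hx
    exact ⟨hrel _ _, hrel _ _⟩

/-- Any two entries are related because the later one was checked against the earlier one in both
orders. The height at `0` vanishes because `reach steps 0` contains only `0`. -/
theorem isConfig_of_mem_extensions {c : ℕ → (Fin d → ℤ) × (Fin n → ℤ) × ℕ}
    (hc : ∀ m, c m ∈ extensions K Tab steps states ((List.range m).map c)) :
    IsConfig K Tab (fun g => (c (siteIndex g)).2.1)
      (fun g => (c (siteIndex g)).2.2) := by
  have hsite : ∀ m, (c m).1 = site d m := fun m => by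
    simpa using (mem_extensions.1 (hc m)).1.1
  have hrel : ∀ i j, siteRel K Tab (c i) (c j) := by
    intro i j
    rcases lt_trichotomy i j with hij | rfl | hij
    · exact ((mem_extensions.1 (hc j)).2.2 _ (List.mem_map.2 ⟨i, by simpa using hij, rfl⟩)).1
    · exact (mem_extensions.1 (hc i)).2.1
    · exact ((mem_extensions.1 (hc i)).2.2 _ (List.mem_map.2 ⟨j, by simpa using hij, rfl⟩)).2
  constructor
  · have := (mem_extensions.1 (hc (siteIndex (0 : Fin d → ℤ)))).1.2.1
    rw [List.length_map, List.length_range, site_siteIndex] at this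
    simpa [latticeNorm, reach] using this
  · intro g h hgh
    have := (hrel (siteIndex g) (siteIndex h)).1
    simp only [hsite, site_siteIndex] at this
    exact this hgh

/-- If for each `k` some `B` passes, for all configurations, the tests `q` on the heights at
finitely many sites, then such a `B` can be computed from `k`. -/
theorem exists_computable_of_forall_isConfig {β : Type*} [Primcodable β] (hd : 0 < d)
    (hKf : K.Finite) (hTab : Tab.Finite) (hK : ∀ l, Pi.single l 1 ∈ K) {N : ℕ}
    {p : Fin N → ℕ → (Fin d → ℤ)} (hp : ∀ l, Primrec (p l))
    {q : ℕ × β → (Fin n → ℤ) → Prop} (hq : PrimrecRel q)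
    (h : ∀ k, ∃ B, ∀ ψ s, IsConfig K Tab ψ s → ∀ l, q (k, B) (ψ (p l k))) :
    ∃ f : ℕ → β, Computable f ∧
      ∀ k, ∀ ψ s, IsConfig K Tab ψ s → ∀ l, q (k, f k) (ψ (p l k)) := by
  classical
  let steps := hTab.toFinset.toList.map (fun t => t.2.1) ++
    hTab.toFinset.toList.map (fun t => -t.2.1)
  let states := hTab.toFinset.toList.map (fun t => t.2.2.1)
  have hsteps : ∀ t ∈ Tab, t.2.1 ∈ steps ∧ -t.2.1 ∈ steps := by
    intro t ht
    simp only [steps, List.mem_append, List.mem_map, Finset.mem_toList, Set.Finite.mem_toFinset]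
    exact ⟨Or.inl ⟨t, ht, rfl⟩, Or.inr ⟨t, ht, rfl⟩⟩
  have hstates : ∀ t ∈ Tab, t.2.2.1 ∈ states := by
    intro t ht
    simp only [states, List.mem_map, Finset.mem_toList, Set.Finite.mem_toFinset]
    exact ⟨t, ht, rfl⟩
  let next := extensions K Tab steps states
  have hnext : Primrec next := primrec_extensions hKf hTab steps states
  let Q : ℕ × β → List ((Fin d → ℤ) × (Fin n → ℤ) × ℕ) → Prop := fun a L =>
    ∀ l, ∃ y ∈ L, y.1 = p l a.1 ∧ q a y.2.1
  have hQ : PrimrecRel Q := by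
    refine primrecPred_forall_fin fun l => ?_
    have h1 : PrimrecRel fun (y : (Fin d → ℤ) × (Fin n → ℤ) × ℕ) (a : ℕ × β) =>
        y.1 = p l a.1 ∧ q a y.2.1 :=
      PrimrecPred.and
        (Primrec.eq.comp (Primrec.fst.comp Primrec.fst)
          ((hp l).comp (Primrec.fst.comp Primrec.snd)))
        (hq.comp Primrec.snd (Primrec.fst.comp (Primrec.snd.comp Primrec.fst)))
    exact h1.exists_mem_list.comp Primrec.snd Primrec.fst
  have hQmono : ∀ a L y, Q a L → Q a (L ++ [y]) := by
    intro a L y hL l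
    obtain ⟨x, hx, hx'⟩ := hL l
    exact ⟨x, List.mem_append_left _ hx, hx'⟩
  -- The depth is made part of the witness: passing on all branches of a given depth is decidable,
  -- passing on all configurations is not known to be.
  have hP : PrimrecRel fun (k : ℕ) (b : β × ℕ) => ∀ L ∈ branches next b.2, Q (k, b.1) L := by
    have h1 : PrimrecRel fun (L : List ((Fin d → ℤ) × (Fin n → ℤ) × ℕ)) (a : ℕ × β) => Q a L :=
      hQ.comp Primrec.snd Primrec.fst
    exact h1.forall_mem_list.comp
      ((primrec_branches hnext).comp (Primrec.snd.comp Primrec.snd))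
      (Primrec.pair Primrec.fst (Primrec.fst.comp Primrec.snd))
  obtain ⟨f, hf, hf'⟩ := exists_computable_choice hP (fun k => by
    obtain ⟨B, hB⟩ := h k
    by_contra! hcon
    obtain ⟨c, hc, hc'⟩ := exists_infinite_branch (next := next) (hQmono (k, B))
      (fun m => by simpa using hcon (B, m))
    have hsite : ∀ m, (c m).1 = site d m := fun m => by
      simpa using (mem_extensions.1 (hc m)).1.1
    -- This depth exceeds the index of every test site, so the prefix visits them all.
    refine hc' (∑ l, (siteIndex (p l k) + 1)) fun l => ?_
    refine ⟨c (siteIndex (p l k)), List.mem_map.2 ⟨_, List.mem_range.2 ?_, rfl⟩,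
      by rw [hsite, site_siteIndex], hB _ _ (isConfig_of_mem_extensions hc) l⟩
    exact Nat.lt_of_lt_of_le (Nat.lt_succ_self _) (Finset.single_le_sum
      (f := fun l => siteIndex (p l k) + 1) (fun _ _ => Nat.zero_le _) (Finset.mem_univ l)))
  refine ⟨fun k => (f k).1, Computable.fst.comp hf, fun k ψ s hψ l => ?_⟩
  obtain ⟨y, hy, hy1, hy2⟩ := hf' k _ (map_range_mem_branches
    (fun m => hψ.mem_extensions hd hK hsteps hstates m) (f k).2) l
  obtain ⟨i, -, rfl⟩ := List.mem_map.1 hy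
  simp only at hy1 hy2
  rwa [← hy1]

/-- Replaces the states of the configurations by natural numbers. -/
theorem exists_computable_of_forall_isConfig' {S β : Type*} [Countable S] [Primcodable β]
    (hd : 0 < d) {Tab : Set ((Fin d → ℤ) × (Fin n → ℤ) × S × S)}
    (hKf : K.Finite) (hTab : Tab.Finite) (hK : ∀ l, Pi.single l 1 ∈ K) {N : ℕ}
    {p : Fin N → ℕ → (Fin d → ℤ)} (hp : ∀ l, Primrec (p l))
    {q : ℕ × β → (Fin n → ℤ) → Prop} (hq : PrimrecRel q)
    (h : ∀ k, ∃ B, ∀ ψ s, IsConfig K Tab ψ s → ∀ l, q (k, B) (ψ (p l k))) :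
    ∃ f : ℕ → β, Computable f ∧
      ∀ k, ∀ ψ s, IsConfig K Tab ψ s → ∀ l, q (k, f k) (ψ (p l k)) := by
  obtain ⟨e, he⟩ := Countable.exists_injective_nat S
  let E : (Fin d → ℤ) × (Fin n → ℤ) × S × S → (Fin d → ℤ) × (Fin n → ℤ) × ℕ × ℕ :=
    fun t => (t.1, t.2.1, e t.2.2.1, e t.2.2.2)
  obtain ⟨f, hf, hf'⟩ := exists_computable_of_forall_isConfig hd hKf (hTab.image E) hK hp hq
    (fun k => by
      obtain ⟨B, hB⟩ := h k
      refine ⟨B, fun ψ s hψ => ?_⟩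
      -- The constraint towards a unit neighbour puts the state of each site in the encoded table,
      -- hence in the range of `e`.
      have hs : ∀ g, ∃ a, s g = e a := by
        intro g
        obtain ⟨t, -, ht⟩ := hψ.2 g (g + Pi.single ⟨0, hd⟩ 1) (by simpa using hK _)
        exact ⟨t.2.2.1, (congrArg (fun t => t.2.2.1) ht).symm⟩
      choose s' hs' using hs
      refine hB ψ s' ⟨hψ.1, fun g g' hg => ?_⟩
      obtain ⟨⟨t1, t2, t3, t4⟩, ht, ht'⟩ := hψ.2 g g' hg
      simp only [E, hs', Prod.mk.injEq, he.eq_iff] at ht'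
      obtain ⟨rfl, rfl, rfl, rfl⟩ := ht'
      exact ht)
  exact ⟨f, hf, fun k ψ s hψ => hf' k ψ (fun g => e (s g))
    ⟨hψ.1, fun g g' hg => ⟨_, hψ.2 g g' hg, rfl⟩⟩⟩

end effective

/-! ### From bounded linear tests to computable coordinates -/

theorem isComputableReal_of_forall_le {x : ℝ} {C : ℕ} {f : ℕ → ℤ} (hf : Computable f)
    (h : ∀ k, |x - (f k : ℝ) / 2 ^ k| ≤ C / 2 ^ k) : IsComputableReal x := by
  -- In units of `2^-k`, the error at precision `k + C + 1` is `C / 2^(C+1) ≤ 1/2`. Adding `2^C`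
  -- before the floor division rounds to the nearest integer and costs at most another `1/2`.
  refine ⟨fun k => (f (k + (C + 1)) + (2 ^ C : ℕ)) / (2 ^ (C + 1) : ℕ), ?_, fun k => ?_⟩
  · refine (primrec_int_div_nat (by positivity)).to_comp.comp ?_
    exact primrec_int_add.to_comp.comp
      (hf.comp (Primrec.nat_add.comp Primrec.id (Primrec.const (C + 1))).to_comp)
      (Computable.const _)
  · set a := f (k + (C + 1)) with ha
    set q := (a + (2 ^ C : ℕ)) / ((2 ^ (C + 1) : ℕ) : ℤ) with hq
    have hpos : (0 : ℤ) < ((2 ^ (C + 1) : ℕ) : ℤ) := by positivity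
    have h1 : ((2 ^ (C + 1) : ℕ) : ℤ) * q ≤ a + (2 ^ C : ℕ) := Int.mul_ediv_self_le hpos.ne'
    have h2 : a + (2 ^ C : ℕ) < ((2 ^ (C + 1) : ℕ) : ℤ) * q + ((2 ^ (C + 1) : ℕ) : ℤ) :=
      Int.lt_mul_ediv_self_add hpos
    have h1' : (2 : ℝ) ^ (C + 1) * q ≤ a + 2 ^ C := by exact_mod_cast h1
    have h2' : (a : ℝ) + 2 ^ C < 2 ^ (C + 1) * q + 2 ^ (C + 1) := by exact_mod_cast h2
    have hC : (C : ℝ) ≤ 2 ^ C := by exact_mod_cast Nat.lt_two_pow_self.le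
    have h3 := h (k + (C + 1))
    rw [← ha, pow_add, abs_le] at h3
    have hk : (0 : ℝ) < 2 ^ k := by positivity
    have hP : (0 : ℝ) < 2 ^ C := by positivity
    rw [pow_succ] at h1' h2' h3
    have e1 : |(a : ℝ) / (2 ^ k * (2 ^ C * 2)) - q / 2 ^ k| ≤ 1 / 2 / 2 ^ k := by
      have : (a : ℝ) / (2 ^ k * (2 ^ C * 2)) - q / 2 ^ k = (a / (2 ^ C * 2) - q) / 2 ^ k := by
        field_simp
      rw [this, abs_div, abs_of_pos hk]
      gcongr
      rw [abs_le]
      constructor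
      · rw [le_sub_iff_add_le, le_div_iff₀ (by positivity)]; linarith
      · rw [sub_le_iff_le_add, div_le_iff₀ (by positivity)]; linarith
    have e2 : (C : ℝ) / (2 ^ k * (2 ^ C * 2)) ≤ 1 / 2 / 2 ^ k := by
      rw [div_div, div_le_div_iff₀ (by positivity) (by positivity)]
      nlinarith
    have e3 : (1 : ℝ) / 2 ^ k = 1 / 2 / 2 ^ k + 1 / 2 / 2 ^ k := by ring
    rw [abs_le] at e1 ⊢
    constructor <;> linarith [h3.1, h3.2, e1.1, e1.2]

theorem primrec_pi {α σ : Type*} [Primcodable α] [Primcodable σ] {N : ℕ} {f : α → Fin N → σ}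
    (h : ∀ i, Primrec fun a => f a i) : Primrec f :=
  Primrec.fin_curry.2 (Primrec₂.swap (Primrec.fin_curry₁.2 h))

theorem primrec_two_pow : Primrec fun k : ℕ => 2 ^ k := by
  refine (Primrec.nat_rec₁ 1 (f := fun _ m => 2 * m)
    (Primrec.nat_mul.comp (Primrec.const 2) Primrec.snd)).of_eq fun k => ?_
  induction k with
  | zero => rfl
  | succ k ih => rw [pow_succ, mul_comm, ← ih]

/-- A subspace of dimension `d` of `ℝ^n` is a graph over `d` of the coordinates. -/
theorem exists_basis_repr_eq_coord {n d : ℕ} (V : Submodule ℝ (Fin n → ℝ))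
    (hV : Module.finrank ℝ V = d) :
    ∃ (ι : Fin d → Fin n) (b : Module.Basis (Fin d) ℝ V), ∀ (y : V) k,
      b.repr y k = (y : Fin n → ℝ) (ι k) := by
  -- The coordinate forms separate the points of `V`, so a maximal independent subfamily of them is
  -- a coordinate system on `V`.
  let c : Fin n → Module.Dual ℝ V := fun i => (LinearMap.proj i).comp V.subtype
  obtain ⟨κ, a, ha, hspan, hli⟩ := exists_linearIndependent' ℝ c
  have : Finite κ := Finite.of_injective a ha
  have := Fintype.ofFinite κ
  have hinj : Function.Injective (LinearMap.pi (fun k => c (a k)) : V →ₗ[ℝ] (κ → ℝ)) := by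
    rw [← LinearMap.ker_eq_bot, LinearMap.ker_eq_bot']
    intro y hy
    have hy' : Submodule.span ℝ (Set.range c) ≤ LinearMap.ker (Module.Dual.eval ℝ V y) := by
      rw [← hspan, Submodule.span_le]
      rintro _ ⟨k, rfl⟩
      exact congrFun hy k
    ext i
    exact hy' (Submodule.subset_span ⟨i, rfl⟩)
  have hcard : Fintype.card κ = d := by
    apply le_antisymm
    · rw [← hV, ← Subspace.dual_finrank_eq]
      exact hli.fintype_card_le_finrank
    · have := LinearMap.finrank_le_finrank_of_injective hinj
      simpa [hV] using this
  let eκ : Fin d ≃ κ := (Fintype.equivFinOfCardEq hcard).symm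
  let L : V →ₗ[ℝ] (Fin d → ℝ) := LinearMap.pi fun k => c (a (eκ k))
  have hL : Function.Injective L := by
    intro x y hxy
    apply hinj
    ext k
    have := congrFun hxy (eκ.symm k)
    simpa [L] using this
  let e : V ≃ₗ[ℝ] (Fin d → ℝ) := LinearEquiv.ofInjectiveOfFinrankEq L hL (by simp [hV])
  exact ⟨a ∘ eκ, Module.Basis.ofEquivFun e, fun y k => rfl⟩

theorem abs_sum_mul_le {ι : Type*} [Fintype ι] (x α : ι → ℝ) :
    |∑ k, x k * α k| ≤ ‖x‖ * ∑ k, |α k| := by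
  rw [Finset.mul_sum]
  refine (Finset.abs_sum_le_sum_abs _ _).trans (Finset.sum_le_sum fun k _ => ?_)
  rw [abs_mul]
  exact mul_le_mul_of_nonneg_right (norm_le_pi_norm x k) (abs_nonneg _)

/-- Vectors close to `V` whose projections are close to the coordinate axes are uniformly
independent. -/
theorem exists_uniform_independence {n d : ℕ} {V : Submodule ℝ (Fin n → ℝ)}
    {ι : Fin d → Fin n} (b : Module.Basis (Fin d) ℝ V)
    (hb : ∀ (y : V) k, b.repr y k = (y : Fin n → ℝ) (ι k))
    {M : (Fin n → ℝ) →ₗ[ℝ] (Fin d → ℝ)} {D δ η w : ℝ} (hM : ∀ x, ‖M x‖ ≤ D * ‖x‖)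
    (hMV : ∀ y ∈ V, M y = 0 → y = 0) (hD : 0 ≤ D) (hw : 0 ≤ w) (hδ : 0 < δ)
    (hη : d * η ≤ δ / 2) :
    ∃ A r₀ : ℝ, 0 ≤ A ∧ ∀ r ≥ r₀, 0 ≤ r → ∀ Y : Fin d → (Fin n → ℝ),
      (∀ l, ∃ y ∈ V, ‖Y l - y‖ ≤ w) →
      (∀ l, ‖M (Y l) - (δ * r) • Pi.single l (1 : ℝ)‖ ≤ η * r) →
      ∀ α : Fin d → ℝ, (∑ k, |α k|) * r ≤ A * ∑ l, |∑ k, Y l (ι k) * α k| := by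
  have hinj : Function.Injective (M.comp V.subtype) := by
    rw [← LinearMap.ker_eq_bot, LinearMap.ker_eq_bot']
    intro y hy
    exact Subtype.ext (hMV y y.2 hy)
  let e : V ≃ₗ[ℝ] (Fin d → ℝ) := LinearEquiv.ofInjectiveOfFinrankEq _ hinj (by
    rw [Module.finrank_eq_card_basis b]; simp)
  have he : ∀ y : V, e y = M y := fun y => rfl
  set C₁ : ℝ := ∑ k, ∑ m, |e (b k) m| with hC₁
  have hC₁0 : 0 ≤ C₁ := by positivity
  refine ⟨4 * C₁ / δ, 4 * (d * w * D + d * w * C₁) / δ, by positivity, ?_⟩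
  intro r hr hr0 Y hY hMY α
  choose y hyV hy using hY
  -- The form with coefficients `α` is read in two bases of `V`: its values on `b` are the `α k`,
  -- and its values on the basis that `M` sends to the canonical one are the `F m`.
  let f : V →ₗ[ℝ] ℝ := Fintype.linearCombination ℝ α ∘ₗ
    (LinearMap.pi fun k => (LinearMap.proj (ι k)).comp V.subtype)
  have hf : ∀ z : V, f z = ∑ k, (z : Fin n → ℝ) (ι k) * α k := fun z => by
    simp [f, Fintype.linearCombination_apply]
  let F : Fin d → ℝ := fun m => f (e.symm (Pi.single m 1))
  have hF : ∀ z : V, f z = ∑ m, e z m * F m := by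
    intro z
    have h1 : z = ∑ m, e z m • e.symm (Pi.single m 1) := by
      apply e.injective
      rw [map_sum]
      simp only [map_smul, LinearEquiv.apply_symm_apply]
      exact pi_eq_sum_univ' (e z)
    conv_lhs => rw [h1]
    simp [F]
  set S : ℝ := ∑ m, |F m| with hS
  have hS0 : 0 ≤ S := by positivity
  have hα : ∑ k, |α k| ≤ C₁ * S := by
    have h1 : ∀ k, α k = f (b k) := by
      intro k
      rw [hf]
      simp_rw [← hb]
      simp [Finsupp.single_apply]
    rw [hC₁, Finset.sum_mul]
    refine Finset.sum_le_sum fun k _ => ?_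
    rw [h1, hF]
    refine (Finset.abs_sum_le_sum_abs _ _).trans ?_
    rw [Finset.sum_mul]
    refine Finset.sum_le_sum fun m _ => ?_
    rw [abs_mul]
    refine mul_le_mul_of_nonneg_left ?_ (abs_nonneg _)
    exact Finset.single_le_sum (f := fun m => |F m|) (fun _ _ => abs_nonneg _) (Finset.mem_univ m)
  -- Diagonal dominance: `M (y l)` is `δ r e_l` up to an error of norm `η r + D w`, and replacing `Y
  -- l` by `y l` costs at most `w * (C₁ * S)`.
  have hlow : ∀ l, δ * r * |F l| - (η * r + D * w) * S ≤
      |∑ k, Y l (ι k) * α k| + w * (C₁ * S) := by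
    intro l
    have h1 : |f ⟨y l, hyV l⟩| ≤ |∑ k, Y l (ι k) * α k| + w * (C₁ * S) := by
      have h2 : f ⟨y l, hyV l⟩ = ∑ k, Y l (ι k) * α k - ∑ k, (Y l (ι k) - y l (ι k)) * α k := by
        rw [hf, ← Finset.sum_sub_distrib]
        exact Finset.sum_congr rfl fun k _ => by ring
      rw [h2]
      refine (abs_sub _ _).trans (add_le_add_right ?_ _)
      refine (abs_sum_mul_le _ _).trans (mul_le_mul ?_ hα (by positivity) hw)
      refine (pi_norm_le_iff_of_nonneg hw).2 fun k => ?_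
      exact (norm_le_pi_norm (Y l - y l) (ι k)).trans (hy l)
    refine le_trans ?_ h1
    obtain ⟨E, hE⟩ : ∃ E : Fin d → ℝ, E = M (y l) - (δ * r) • Pi.single l (1 : ℝ) := ⟨_, rfl⟩
    have h3 : f ⟨y l, hyV l⟩ = δ * r * F l + ∑ m, E m * F m := by
      have h31 : M (y l) = (δ * r) • Pi.single l (1 : ℝ) + E := by rw [hE]; abel
      have h32 : ∑ m, ((δ * r) • (Pi.single l (1 : ℝ) : Fin d → ℝ)) m * F m = δ * r * F l := by
        rw [Finset.sum_eq_single l]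
        · simp
        · intro m _ hm
          simp [Pi.single_eq_of_ne hm]
        · simp
      rw [hF, he, h31, ← h32, ← Finset.sum_add_distrib]
      exact Finset.sum_congr rfl fun m _ => by rw [Pi.add_apply, add_mul]
    have h4 : ‖E‖ ≤ η * r + D * w := by
      have : E = (M (Y l) - (δ * r) • Pi.single l (1 : ℝ)) - M (Y l - y l) := by
        rw [map_sub, hE]; abel
      rw [this]
      refine (norm_sub_le _ _).trans (add_le_add (hMY l) ((hM _).trans ?_))
      exact mul_le_mul_of_nonneg_left (hy l) hD
    have h5 := (abs_sum_mul_le E F).trans (mul_le_mul_of_nonneg_right h4 hS0)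
    have h6 : |δ * r * F l| = δ * r * |F l| := by
      rw [abs_mul, abs_of_nonneg (by positivity)]
    rw [h3]
    have h7 := abs_sub_abs_le_abs_add (δ * r * F l) (∑ m, E m * F m)
    linarith
  have hsum := Finset.sum_le_sum fun l (_ : l ∈ Finset.univ) => hlow l
  rw [Finset.sum_sub_distrib, ← Finset.mul_sum, ← hS, Finset.sum_add_distrib] at hsum
  simp only [Finset.sum_const, Finset.card_univ, Fintype.card_fin, nsmul_eq_mul] at hsum
  set T := ∑ l, |∑ k, Y l (ι k) * α k| with hT
  -- Of the main term `δ r S`, the hypothesis on `d * η` uses half, and the choice of `r₀` lets the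
  -- errors independent of `r` use only a further quarter.
  have h8 : 4 * (d * w * D + d * w * C₁) ≤ δ * r := by
    rw [ge_iff_le, div_le_iff₀ hδ] at hr; linarith
  have h9 : δ * r / 4 * S ≤ T := by
    nlinarith [mul_le_mul_of_nonneg_right h8 hS0,
      mul_le_mul_of_nonneg_right (mul_le_mul_of_nonneg_right hη hr0) hS0]
  calc (∑ k, |α k|) * r ≤ C₁ * S * r := mul_le_mul_of_nonneg_right hα hr0
    _ = 4 * C₁ / δ * (δ * r / 4 * S) := by field_simp
    _ ≤ 4 * C₁ / δ * T := mul_le_mul_of_nonneg_left h9 (by positivity)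

/-- An integer vector, seen in `ℝ^n`. -/
def castVec {n : ℕ} (z : Fin n → ℤ) : Fin n → ℝ := fun i => (z i : ℝ)

/-- Clearing the denominator `2 ^ a.1` turns the approximate equation of the graph into an
inequality between integers. -/
theorem primrecRel_linear_test {d n : ℕ} (ι : Fin d → Fin n) (j : Fin n) (H : ℕ) :
    PrimrecRel fun (a : ℕ × (Fin d → ℤ)) (z : Fin n → ℤ) =>
      (∑ i, z (ι i) * a.2 i - ((2 ^ a.1 : ℕ) : ℤ) * z j).natAbs ≤ H * 2 ^ a.1 := by
  have hpow : Primrec₂ fun (a : ℕ × (Fin d → ℤ)) (_ : Fin n → ℤ) => 2 ^ a.1 :=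
    primrec_two_pow.comp (Primrec.fst.comp Primrec.fst)
  have hz : ∀ i : Fin n, Primrec₂ fun (_ : ℕ × (Fin d → ℤ)) (z : Fin n → ℤ) => z i := fun i =>
    Primrec.fin_app.comp Primrec.snd (Primrec.const i)
  have hB : ∀ i, Primrec₂ fun (a : ℕ × (Fin d → ℤ)) (_ : Fin n → ℤ) => a.2 i := fun i =>
    Primrec.fin_app.comp (Primrec.snd.comp Primrec.fst) (Primrec.const i)
  have hsum : Primrec₂ fun (a : ℕ × (Fin d → ℤ)) (z : Fin n → ℤ) => ∑ i, z (ι i) * a.2 i :=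
    primrec_finset_sum_int Finset.univ fun i => primrec_int_mul.comp (hz (ι i)) (hB i)
  exact Primrec.nat_le.comp
    (primrec_int_natAbs.comp (primrec_int_sub.comp hsum
      (primrec_int_mul.comp (primrec_int_natCast.comp hpow) (hz j))))
    (Primrec.nat_mul.comp (Primrec.const H) hpow)

/-- If the heights of all configurations stay close to `V` and their projections follow `ℤ^d`, then
`V` is computable. -/
theorem isComputableSubspace_of_isConfig {n d : ℕ} {S : Type*} [Countable S] (hd : 0 < d)
    {K : Set (Fin d → ℤ)} {Tab : Set ((Fin d → ℤ) × (Fin n → ℤ) × S × S)}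
    (hKf : K.Finite) (hTab : Tab.Finite) (hK : ∀ l, Pi.single l 1 ∈ K)
    {V : Submodule ℝ (Fin n → ℝ)} (hV : Module.finrank ℝ V = d)
    {M : (Fin n → ℝ) →ₗ[ℝ] (Fin d → ℝ)} {D δ η w C : ℝ} (hM : ∀ x, ‖M x‖ ≤ D * ‖x‖)
    (hMV : ∀ y ∈ V, M y = 0 → y = 0) (hD : 0 ≤ D) (hw : 0 ≤ w) (hδ : 0 < δ)
    (hη : d * η ≤ δ / 2) (hC : 0 ≤ C) (hne : ∃ ψ s, IsConfig K Tab ψ s)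
    (hnear : ∀ ψ s, IsConfig K Tab ψ s → ∀ g, ∃ y ∈ V, ‖castVec (ψ g) - y‖ ≤ w)
    (hdrift : ∀ ψ s, IsConfig K Tab ψ s → ∀ (r : ℕ) l,
      ‖M (castVec (ψ (Pi.single l (r : ℤ)))) - (δ * r) • Pi.single l (1 : ℝ)‖ ≤ η * r)
    (hbd : ∀ ψ s, IsConfig K Tab ψ s → ∀ (r : ℕ) l,
      ‖castVec (ψ (Pi.single l (r : ℤ)))‖ ≤ C * r) :
    IsComputableSubspace V := by
  obtain ⟨ι, b, hb⟩ := exists_basis_repr_eq_coord V hV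
  suffices h : ∀ j k, IsComputableReal ((b k : Fin n → ℝ) j) by
    refine ⟨b.reindex (finCongr hV.symm), fun i j => ?_⟩
    rw [Module.Basis.reindex_apply]
    exact h j _
  intro j
  obtain ⟨A, r₀, hA, hind⟩ := exists_uniform_independence b hb hM hMV hD hw hδ hη
  set β : Fin d → ℝ := fun k => (b k : Fin n → ℝ) j with hβ
  have hyβ : ∀ y ∈ V, y j = ∑ k, y (ι k) * β k := by
    intro y hy
    have h1 := congrArg (fun z : V => (z : Fin n → ℝ) j) (b.sum_repr ⟨y, hy⟩)
    simp only [hb, Submodule.coe_sum, Submodule.coe_smul, Finset.sum_apply, Pi.smul_apply,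
      smul_eq_mul] at h1
    exact h1.symm
  set W : ℝ := w * ∑ k, |β k| + w with hW
  have hclose : ∀ Y : Fin n → ℝ, (∃ y ∈ V, ‖Y - y‖ ≤ w) → |∑ k, Y (ι k) * β k - Y j| ≤ W := by
    rintro Y ⟨y, hy, hyw⟩
    have h1 : ∑ k, Y (ι k) * β k - Y j = ∑ k, (Y (ι k) - y (ι k)) * β k - (Y - y) j := by
      simp only [sub_mul, Finset.sum_sub_distrib, ← hyβ y hy, Pi.sub_apply]
      ring
    rw [h1]
    refine (abs_sub _ _).trans (add_le_add ?_ ((norm_le_pi_norm (Y - y) j).trans hyw))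
    refine (abs_sum_mul_le _ _).trans (mul_le_mul_of_nonneg_right ?_ (by positivity))
    exact (pi_norm_le_iff_of_nonneg hw).2 fun k => (norm_le_pi_norm (Y - y) (ι k)).trans hyw
  have hW0 : 0 ≤ W := by positivity
  obtain ⟨R, hR⟩ := exists_nat_ge (max r₀ 1)
  have hR0 : r₀ ≤ R := (le_max_left _ _).trans hR
  have hR1 : (1 : ℝ) ≤ R := (le_max_right _ _).trans hR
  obtain ⟨H, hH⟩ := exists_nat_ge (C * R * d + W)
  let p : Fin d → ℕ → (Fin d → ℤ) := fun l k => Pi.single l ((R * 2 ^ k : ℕ) : ℤ)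
  have hp : ∀ l, Primrec (p l) := by
    intro l
    refine primrec_pi fun i => ?_
    by_cases hi : i = l
    · subst hi
      simp only [p, Pi.single_eq_same]
      exact primrec_int_natCast.comp (Primrec.nat_mul.comp (Primrec.const R) primrec_two_pow)
    · simp only [p, Pi.single_eq_of_ne hi]
      exact Primrec.const 0
  have htest : ∀ (k : ℕ) (B : Fin d → ℤ) (z : Fin n → ℤ),
      ((∑ i, z (ι i) * B i - ((2 ^ k : ℕ) : ℤ) * z j).natAbs ≤ H * 2 ^ k) ↔
      |∑ i, castVec z (ι i) * (B i / 2 ^ k) - castVec z j| ≤ H := by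
    intro k B z
    have h2 : (0 : ℝ) < 2 ^ k := by positivity
    rw [← Nat.cast_le (α := ℝ), Nat.cast_natAbs, Int.cast_abs]
    push_cast
    rw [← div_le_iff₀ h2]
    have h3 : |∑ i, (z (ι i) : ℝ) * B i - 2 ^ k * z j| / 2 ^ k =
        |∑ i, castVec z (ι i) * (B i / 2 ^ k) - castVec z j| := by
      conv_lhs => rw [← abs_of_pos h2, ← abs_div, abs_of_pos h2]
      congr 1
      rw [sub_div, Finset.sum_div, mul_div_cancel_left₀ _ h2.ne']
      simp only [castVec, mul_div_assoc]
    rw [h3]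
  obtain ⟨f, hf, hf'⟩ := exists_computable_of_forall_isConfig' hd hKf hTab hK hp
    (primrecRel_linear_test ι j H) (fun k => by
      -- Heights of norm at most `C R 2^k` cancel the rounding errors `2^-k`, contributing at most
      -- `C R d`; the distance to `V` contributes `W`. This is the choice of `H`.
      refine ⟨fun i => ⌊2 ^ k * β i⌋, fun ψ s hψ l => ?_⟩
      simp only [htest]
      have h2 : (0 : ℝ) < 2 ^ k := by positivity
      set Y := castVec (ψ (p l k)) with hY
      have h3 : ∑ i, Y (ι i) * ((⌊2 ^ k * β i⌋ : ℤ) / 2 ^ k) - Y j =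
          ∑ i, Y (ι i) * ((⌊2 ^ k * β i⌋ : ℤ) / 2 ^ k - β i) + (∑ i, Y (ι i) * β i - Y j) := by
        simp only [mul_sub, Finset.sum_sub_distrib]; ring
      rw [h3]
      refine (abs_add_le _ _).trans (le_trans (add_le_add ?_ (hclose _ (hnear ψ s hψ _))) hH)
      have h4 : ‖fun i => Y (ι i)‖ ≤ C * (R * 2 ^ k) := by
        refine (pi_norm_le_iff_of_nonneg (by positivity)).2 fun i => ?_
        have := hbd ψ s hψ (R * 2 ^ k) l
        push_cast at this
        exact (norm_le_pi_norm Y (ι i)).trans (by simpa [hY, p] using this)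
      have h5 : ∑ i, |((⌊2 ^ k * β i⌋ : ℤ) : ℝ) / 2 ^ k - β i| ≤ d * (1 / 2 ^ k) := by
        refine (Finset.sum_le_card_nsmul _ _ (1 / 2 ^ k) fun i _ => ?_).trans (by simp)
        have h6 : ((⌊2 ^ k * β i⌋ : ℤ) : ℝ) / 2 ^ k - β i = (⌊2 ^ k * β i⌋ - 2 ^ k * β i) / 2 ^ k := by
          field_simp
        rw [h6, abs_div, abs_of_pos h2]
        gcongr
        rw [abs_le]
        constructor <;> linarith [Int.floor_le (2 ^ k * β i), Int.lt_floor_add_one (2 ^ k * β i)]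
      refine (abs_sum_mul_le (fun i => Y (ι i)) _).trans ?_
      refine (mul_le_mul h4 h5 (by positivity) (by positivity)).trans (le_of_eq ?_)
      field_simp)
  intro i
  obtain ⟨C', hC'⟩ := exists_nat_ge (A * (d * (2 * H)))
  refine isComputableReal_of_forall_le (C := C') (f := fun k => f k i)
    ((Primrec.fin_app.comp Primrec.id (Primrec.const i)).to_comp.comp hf) fun k => ?_
  obtain ⟨ψ, s, hψ⟩ := hne
  have h2 : (1 : ℝ) ≤ 2 ^ k := one_le_pow₀ (by norm_num)
  have h2' : (0 : ℝ) < 2 ^ k := by positivity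
  have hWH : W ≤ H := le_trans (by nlinarith [show 0 ≤ C * R * d by positivity]) hH
  have hcast : ((R * 2 ^ k : ℕ) : ℝ) = R * 2 ^ k := by push_cast; ring
  have key := hind (R * 2 ^ k) (by nlinarith) (by positivity) (fun l => castVec (ψ (p l k)))
    (fun l => hnear ψ s hψ _)
    (fun l => by have := hdrift ψ s hψ (R * 2 ^ k) l; rwa [hcast] at this)
    (fun i => f k i / 2 ^ k - β i)
  -- Both the computed coefficients and `β` pass the test, so their difference is nearly annihilated
  -- by the independent heights.
  have h7 : ∀ l, |∑ i, castVec (ψ (p l k)) (ι i) * ((f k i : ℝ) / 2 ^ k - β i)| ≤ 2 * H := by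
    intro l
    have h8 := (htest _ _ _).1 (hf' k ψ s hψ l)
    have h9 := hclose _ (hnear ψ s hψ (p l k))
    set Y := castVec (ψ (p l k)) with hY
    have h10 : ∑ i, Y (ι i) * ((f k i : ℝ) / 2 ^ k - β i) =
        (∑ i, Y (ι i) * ((f k i : ℝ) / 2 ^ k) - Y j) - (∑ i, Y (ι i) * β i - Y j) := by
      simp only [mul_sub, Finset.sum_sub_distrib]; ring
    rw [h10]
    refine (abs_sub _ _).trans ?_
    linarith
  have h11 := Finset.sum_le_card_nsmul Finset.univ _ _ fun l _ => h7 l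
  rw [Finset.card_univ, Fintype.card_fin, nsmul_eq_mul] at h11
  have h12 := Finset.single_le_sum (f := fun i => |(f k i : ℝ) / 2 ^ k - β i|)
    (fun _ _ => abs_nonneg _) (Finset.mem_univ i)
  have h13 := mul_le_mul_of_nonneg_left h11 hA
  rw [le_div_iff₀ h2', abs_sub_comm]
  have h14 : |(f k i : ℝ) / 2 ^ k - β i| * 2 ^ k ≤ |(f k i : ℝ) / 2 ^ k - β i| * (R * 2 ^ k) :=
    mul_le_mul_of_nonneg_left (by nlinarith) (abs_nonneg _)
  have h15 : |(f k i : ℝ) / 2 ^ k - β i| * (R * 2 ^ k) ≤ _ :=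
    (mul_le_mul_of_nonneg_right h12 (by positivity)).trans key
  linarith

/-! ### Geometry of tilings and rigidity of lifts -/

variable {n d : ℕ} {v : Fin n → Fin d → ℝ}

/-- The linear map `ℝ^n → ℝ^d` that maps the `i`-th canonical basis vector to `v i`. -/
noncomputable def projMap (v : Fin n → Fin d → ℝ) : (Fin n → ℝ) →ₗ[ℝ] (Fin d → ℝ) :=
  Fintype.linearCombination ℝ v

theorem projMap_apply (x : Fin n → ℝ) : projMap v x = ∑ i, x i • v i :=
  Fintype.linearCombination_apply ℝ v x

/-- A bound on the size of all tiles. -/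
noncomputable def tileSize (v : Fin n → Fin d → ℝ) : ℝ := ∑ i, ‖v i‖

theorem tileSize_nonneg : 0 ≤ tileSize v := Finset.sum_nonneg fun _ _ => norm_nonneg _

theorem norm_projMap_le (x : Fin n → ℝ) : ‖projMap v x‖ ≤ tileSize v * ‖x‖ := by
  rw [projMap_apply, tileSize, Finset.sum_mul]
  refine (norm_sum_le _ _).trans (Finset.sum_le_sum fun i _ => ?_)
  rw [norm_smul, mul_comm]
  exact mul_le_mul_of_nonneg_left (norm_le_pi_norm x i) (norm_nonneg _)

theorem castVec_add (a b : Fin n → ℤ) : castVec (a + b) = castVec a + castVec b := by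
  ext i; simp [castVec]

theorem castVec_sub (a b : Fin n → ℤ) : castVec (a - b) = castVec a - castVec b := by
  ext i; simp [castVec]

theorem castVec_zero : castVec (0 : Fin n → ℤ) = 0 := by
  ext i; simp [castVec]

theorem projMap_castVec_sum_single (K : Finset (Fin n)) :
    projMap v (castVec (∑ i ∈ K, Pi.single i (1 : ℤ))) = ∑ i ∈ K, v i := by
  have h : castVec (∑ i ∈ K, Pi.single i (1 : ℤ)) = ∑ i ∈ K, Pi.single i (1 : ℝ) := by
    ext j
    simp [castVec, Finset.sum_apply, Pi.single_apply]
  rw [h, map_sum]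
  exact Finset.sum_congr rfl fun i _ => by
    rw [projMap, Fintype.linearCombination_apply_single, one_smul]

theorem base_mem_cell {m : ℕ} (u : Fin n → Fin m → ℝ) (x : Fin m → ℝ) (I : Finset (Fin n)) :
    x ∈ cell u x I :=
  ⟨0, by simp, by simp⟩

theorem mem_cell_translate {m : ℕ} (u : Fin n → Fin m → ℝ) (x a p : Fin m → ℝ)
    (I : Finset (Fin n)) : p ∈ cell u (x + a) I ↔ p - a ∈ cell u x I := by
  constructor
  · rintro ⟨s, hs, rfl⟩
    exact ⟨s, hs, by abel⟩
  · rintro ⟨s, hs, h⟩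
    exact ⟨s, hs, by rw [sub_eq_iff_eq_add.1 h]; abel⟩

theorem norm_sub_le_of_mem_cell {x p : Fin d → ℝ} {I : Finset (Fin n)} (h : p ∈ cell v x I) :
    ‖p - x‖ ≤ tileSize v := by
  obtain ⟨s, hs, rfl⟩ := h
  rw [add_sub_cancel_left]
  refine (norm_sum_le _ _).trans (le_trans (Finset.sum_le_sum (g := fun i => ‖v i‖) fun i hi => ?_)
    (Finset.sum_le_sum_of_subset_of_nonneg (Finset.subset_univ I) fun _ _ _ => norm_nonneg _))
  rw [norm_smul, Real.norm_eq_abs, abs_of_nonneg (hs i hi).1]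
  exact mul_le_of_le_one_left (norm_nonneg _) (hs i hi).2

theorem isClosed_cell (x : Fin d → ℝ) (I : Finset (Fin n)) : IsClosed (cell v x I) := by
  have h : cell v x I = (fun s : Fin n → ℝ => x + ∑ i ∈ I, s i • v i) ''
      Set.univ.pi (fun _ => Set.Icc 0 1) := by
    ext p
    constructor
    · rintro ⟨s, hs, rfl⟩
      refine ⟨fun i => if i ∈ I then s i else 0, fun i _ => ?_, ?_⟩
      · by_cases hi : i ∈ I
        · simpa [hi] using hs i hi
        · simp [hi]
      · simp only [add_right_inj]
        exact Finset.sum_congr rfl fun i hi => by simp [hi]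
    · rintro ⟨s, hs, rfl⟩
      exact ⟨s, fun i _ => hs i trivial, rfl⟩
  rw [h]
  refine IsCompact.isClosed ((isCompact_univ_pi fun _ => isCompact_Icc).image ?_)
  fun_prop

/-- The coefficients of a combination of independent vectors are unique. -/
theorem eqOn_of_sum_smul_eq {m : ℕ} {u : Fin n → Fin m → ℝ} {I : Finset (Fin n)}
    (hI : LinearIndepOn ℝ u (I : Set (Fin n))) {a b : Fin n → ℝ}
    (h : ∑ i ∈ I, a i • u i = ∑ i ∈ I, b i • u i) : ∀ i ∈ I, a i = b i := by
  have h1 := linearIndepOn_finset_iff.1 hI (fun i => a i - b i) (by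
    simp only [sub_smul, Finset.sum_sub_distrib, h, sub_self])
  exact fun i hi => sub_eq_zero.1 (h1 i hi)

theorem sum_smul_indicator {m : ℕ} {u : Fin n → Fin m → ℝ} {I K : Finset (Fin n)} (hK : K ⊆ I)
    (s : Fin n → ℝ) : ∑ i ∈ I, (if i ∈ K then s i else 0) • u i = ∑ i ∈ K, s i • u i := by
  rw [← Finset.sum_subset hK]
  · exact Finset.sum_congr rfl fun i hi => by simp [hi]
  · intro i _ hi
    simp [hi]

/-- A point of a proper face has a coefficient `0` or `1`. -/
theorem Tile.IsProperFace.exists_coeff {t : Tile n d} (ht : t.IsValid v) {F : Set (Fin d → ℝ)}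
    (hF : t.IsProperFace v F) {a : Fin n → ℝ} (ha : t.base + ∑ i ∈ t.idx, a i • v i ∈ F) :
    ∃ i ∈ t.idx, a i = 0 ∨ a i = 1 := by
  obtain ⟨J, K, hJ, hK, rfl⟩ := hF
  obtain ⟨s, hs, h⟩ := ha
  obtain ⟨i, hi, hiJ⟩ := Finset.exists_of_ssubset hJ
  have hK' : K ⊆ t.idx := hK.trans Finset.sdiff_subset
  rw [add_assoc, add_right_inj, ← sum_smul_indicator hJ.1 s] at h
  have h1 : ∑ i ∈ K, v i = ∑ i ∈ t.idx, (if i ∈ K then (1 : ℝ) else 0) • v i := by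
    rw [sum_smul_indicator hK']; simp
  rw [h1, ← Finset.sum_add_distrib] at h
  simp only [← add_smul] at h
  have h2 := eqOn_of_sum_smul_eq ht.2 h i hi
  refine ⟨i, hi, ?_⟩
  rw [h2]
  by_cases hiK : i ∈ K <;> simp [hiJ, hiK]

/-- The centre of `s` would also lie in `t`, but no proper face of `s` contains it. -/
theorem IsTiling.eq_of_close {T : Set (Tile n d)} (hT : IsTiling v T) {s t : Tile n d}
    (hs : s ∈ T) (ht : t ∈ T) (hidx : s.idx = t.idx) {a : Fin n → ℝ}
    (ha : t.base = s.base + ∑ i ∈ s.idx, a i • v i) (ha' : ∀ i ∈ s.idx, |a i| ≤ 1 / 2) :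
    s = t := by
  by_contra hst
  have h1 : s.base + ∑ i ∈ s.idx, (1 / 2 : ℝ) • v i ∈ s.carrier v :=
    ⟨fun _ => 1 / 2, fun i _ => by norm_num, rfl⟩
  have h2 : s.base + ∑ i ∈ s.idx, (1 / 2 : ℝ) • v i ∈ t.carrier v := by
    refine ⟨fun i => 1 / 2 - a i, fun i hi => ?_, ?_⟩
    · have := abs_le.1 (ha' i (hidx ▸ hi))
      constructor <;> linarith [this.1, this.2]
    · rw [ha, ← hidx]
      simp only [sub_smul, Finset.sum_sub_distrib]
      abel
  obtain ⟨i, -, hi⟩ := (hT.face_to_face s hs t ht hst ⟨_, h1, h2⟩).1.exists_coeff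
    (hT.valid s hs) (a := fun _ => 1 / 2) ⟨h1, h2⟩
  norm_num at hi

theorem IsTiling.finite_meeting {T : Set (Tile n d)} (hT : IsTiling v T) {B : Set (Fin d → ℝ)}
    (hB : Bornology.IsBounded B) : {t ∈ T | (t.carrier v ∩ B).Nonempty}.Finite := by
  obtain ⟨R, hR⟩ := hB.subset_closedBall (0 : Fin d → ℝ)
  have hsub : {t ∈ T | (t.carrier v ∩ B).Nonempty} ⊆
      ⋃ I : Finset (Fin n), {t ∈ T | t.idx = I ∧ ‖t.base‖ ≤ R + tileSize v} := by
    rintro t ⟨ht, p, hp, hpB⟩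
    refine Set.mem_iUnion.2 ⟨t.idx, ht, rfl, ?_⟩
    have h1 := norm_sub_le_of_mem_cell hp
    have h2 := mem_closedBall_zero_iff.1 (hR hpB)
    have h3 := norm_sub_le p (p - t.base)
    rw [sub_sub_cancel] at h3
    linarith
  refine Set.Finite.subset (Set.finite_iUnion fun I => ?_) hsub
  rcases Set.eq_empty_or_nonempty {t ∈ T | t.idx = I ∧ ‖t.base‖ ≤ R + tileSize v} with h | ⟨t₀, h₀⟩
  · rw [h]; exact Set.finite_empty
  have hval := hT.valid t₀ h₀.1
  rw [Tile.IsValid, h₀.2.1] at hval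
  have hli : LinearIndependent ℝ (fun i : I => v i) := hval.2
  let b : Module.Basis I ℝ (Fin d → ℝ) :=
    basisOfLinearIndependentOfCardEqFinrank' _ hli (by simp [hval.1])
  let e : (Fin d → ℝ) ≃L[ℝ] (I → ℝ) := b.equivFun.toContinuousLinearEquiv
  have he : ∀ x, x = ∑ i : I, e x i • v i := by
    intro x
    conv_lhs => rw [← b.sum_equivFun x]
    exact Finset.sum_congr rfl fun i _ => by simp [b, e]
  let C : ℤ := ⌈2 * (‖(e : (Fin d → ℝ) →L[ℝ] (I → ℝ))‖ * (R + tileSize v))⌉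
  -- On a grid of mesh `1/2` in the coordinates of the generators, two tiles with origins in the
  -- same box coincide by `eq_of_close`.
  let F : Tile n d → (I → ℤ) := fun t i => ⌊2 * e t.base i⌋
  refine Set.Finite.of_finite_image (f := F)
    ((Set.finite_Icc (fun _ => -C) (fun _ => C)).subset ?_) ?_
  · rintro _ ⟨t, ⟨-, -, ht⟩, rfl⟩
    have h1 : ∀ i, |e t.base i| ≤ ‖(e : (Fin d → ℝ) →L[ℝ] (I → ℝ))‖ * (R + tileSize v) :=
      fun i => (norm_le_pi_norm (e t.base) i).trans
        (((e : (Fin d → ℝ) →L[ℝ] (I → ℝ)).le_opNorm t.base).trans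
          (mul_le_mul_of_nonneg_left ht (norm_nonneg _)))
    refine ⟨fun i => ?_, fun i => ?_⟩
    · have h2 := Int.le_ceil (2 * (‖(e : (Fin d → ℝ) →L[ℝ] (I → ℝ))‖ * (R + tileSize v)))
      refine Int.le_floor.2 ?_
      push_cast
      linarith [(abs_le.1 (h1 i)).1]
    · have h2 := Int.le_ceil (2 * (‖(e : (Fin d → ℝ) →L[ℝ] (I → ℝ))‖ * (R + tileSize v)))
      refine Int.floor_le_iff.2 ?_
      linarith [(abs_le.1 (h1 i)).2]
  · intro s hs t ht hst
    have hclose : ∀ i : I, |e t.base i - e s.base i| ≤ 1 / 2 := by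
      intro i
      have h1 : ⌊2 * e s.base i⌋ = ⌊2 * e t.base i⌋ := congrFun hst i
      have h2 := Int.abs_sub_lt_one_of_floor_eq_floor h1
      rw [← mul_sub, abs_mul, abs_two, abs_sub_comm] at h2
      linarith
    refine hT.eq_of_close hs.1 ht.1 (hs.2.1.trans ht.2.1.symm)
      (a := fun i => if h : i ∈ I then e t.base ⟨i, h⟩ - e s.base ⟨i, h⟩ else 0) ?_ ?_
    · rw [hs.2.1, ← Finset.sum_coe_sort]
      simp only [Subtype.coe_eta, Finset.coe_mem, dif_pos, sub_smul, Finset.sum_sub_distrib]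
      rw [← he, ← he]
      abel
    · intro i hi
      rw [hs.2.1] at hi
      simpa [hi] using hclose ⟨i, hi⟩

/-- Two independent families of vectors that span the same cell: its vertex `x` is a vertex for
the other description. -/
theorem exists_vertex_of_cell_eq {x y : Fin d → ℝ} {I J : Finset (Fin n)}
    (hI : LinearIndepOn ℝ v (I : Set (Fin n))) (hJ : LinearIndepOn ℝ v (J : Set (Fin n)))
    (h : cell v x I = cell v y J) : ∃ K ⊆ J, x = y + ∑ i ∈ K, v i := by
  have hx : x ∈ cell v y J := h ▸ base_mem_cell v x I
  obtain ⟨s, hs, hxs⟩ := hx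
  -- Otherwise `x + ε v i` and `x - ε v i` both lie in the cell of which `x` is an extreme point:
  -- their coefficients over `I` are non-negative with zero sum, so `v i = 0`.
  have key : ∀ i ∈ J, s i = 0 ∨ s i = 1 := by
    intro i hi
    by_contra! hne
    have h0 : 0 < s i := lt_of_le_of_ne (hs i hi).1 (Ne.symm hne.1)
    have h1 : s i < 1 := lt_of_le_of_ne (hs i hi).2 hne.2
    obtain ⟨ε, hε, hε0, hε1⟩ : ∃ ε > 0, ε ≤ s i ∧ ε ≤ 1 - s i :=
      ⟨min (s i) (1 - s i), lt_min h0 (by linarith), min_le_left _ _, min_le_right _ _⟩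
    have hmem : ∀ c : ℝ, |c| ≤ ε → x + c • v i ∈ cell v x I := by
      intro c hc
      rw [h]
      refine ⟨fun j => s j + if j = i then c else 0, fun j hj => ?_, ?_⟩
      · by_cases hji : j = i
        · subst hji
          have := abs_le.1 hc
          simp only [if_true]
          constructor <;> linarith [this.1, this.2]
        · simpa [hji] using hs j hj
      · simp only [add_smul, Finset.sum_add_distrib, ite_smul, zero_smul, Finset.sum_ite_eq', hi,
          if_true]
        rw [← add_assoc, ← hxs]
    obtain ⟨a, ha, ha'⟩ := hmem ε (abs_of_pos hε).le
    obtain ⟨b, hb, hb'⟩ := hmem (-ε) (by rw [abs_neg, abs_of_pos hε])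
    rw [add_right_inj] at ha' hb'
    have hsum : ∑ j ∈ I, (a j + b j) • v j = ∑ j ∈ I, (0 : ℝ) • v j := by
      simp only [add_smul, Finset.sum_add_distrib, ← ha', ← hb']
      simp
    have hzero := eqOn_of_sum_smul_eq hI hsum
    have ha0 : ∑ j ∈ I, a j • v j = 0 := Finset.sum_eq_zero fun j hj => by
      have : a j = 0 := by linarith [hzero j hj, (ha j hj).1, (hb j hj).1]
      rw [this, zero_smul]
    rw [ha0] at ha'
    have hvi : v i ≠ 0 := hJ.ne_zero hi
    exact (smul_ne_zero hε.ne' hvi) ha'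
  classical
  refine ⟨J.filter fun i => s i = 1, Finset.filter_subset _ _, ?_⟩
  rw [hxs, add_right_inj, Finset.sum_filter]
  refine Finset.sum_congr rfl fun i hi => ?_
  rcases key i hi with h0 | h1
  · simp [h0]
  · simp [h1]

/-- A vertex of the common face is a vertex of both tiles; it ties their lifts together. -/
theorem IsTiling.exists_common_vertex {T : Set (Tile n d)} (hT : IsTiling v T) {s t : Tile n d}
    (hs : s ∈ T) (ht : t ∈ T) (hst : (s.carrier v ∩ t.carrier v).Nonempty) :
    ∃ K ⊆ s.idx, ∃ L ⊆ t.idx, s.base + ∑ i ∈ K, v i = t.base + ∑ i ∈ L, v i := by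
  by_cases heq : s = t
  · subst heq
    exact ⟨∅, by simp, ∅, by simp, rfl⟩
  obtain ⟨⟨J, K, hJ, hK, h1⟩, ⟨J', K', hJ', hK', h2⟩⟩ := hT.face_to_face s hs t ht heq hst
  have hI := (hT.valid s hs).2.mono (Finset.coe_subset.2 hJ.1)
  have hI' := (hT.valid t ht).2.mono (Finset.coe_subset.2 hJ'.1)
  obtain ⟨L, hL, hx⟩ := exists_vertex_of_cell_eq hI hI' (h1.symm.trans h2)
  refine ⟨K, hK.trans Finset.sdiff_subset, K' ∪ L,
    Finset.union_subset (hK'.trans Finset.sdiff_subset) (hL.trans hJ'.1), ?_⟩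
  rw [hx, Finset.sum_union, add_assoc]
  rw [Finset.disjoint_left]
  intro i hi hiL
  exact (Finset.mem_sdiff.1 (hK' hi)).2 (hL hiL)

/-- A function on tiles that takes the same value on tiles that meet is constant on the tiles that
meet a bounded connected set. -/
theorem IsTiling.eq_of_isPreconnected {T : Set (Tile n d)} (hT : IsTiling v T)
    {B : Set (Fin d → ℝ)} (hB : Bornology.IsBounded B) (hBc : IsPreconnected B) {α : Type*}
    {f : Tile n d → α}
    (hf : ∀ s ∈ T, ∀ t ∈ T, (s.carrier v ∩ B).Nonempty → (t.carrier v ∩ B).Nonempty →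
      (s.carrier v ∩ t.carrier v).Nonempty → f s = f t) {s t : Tile n d} (hs : s ∈ T) (ht : t ∈ T)
    (hsB : (s.carrier v ∩ B).Nonempty) (htB : (t.carrier v ∩ B).Nonempty) : f s = f t := by
  by_contra hne
  set T₀ := {t ∈ T | (t.carrier v ∩ B).Nonempty} with hT₀
  have hfin : T₀.Finite := hT.finite_meeting hB
  have hcl : ∀ U ⊆ T₀, IsClosed (⋃ r ∈ U, r.carrier v) := fun U hU =>
    (hfin.subset hU).isClosed_biUnion fun r _ => isClosed_cell _ _
  have hcov : B ⊆ (⋃ r ∈ {r ∈ T₀ | f r = f s}, r.carrier v) ∪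
      ⋃ r ∈ {r ∈ T₀ | f r ≠ f s}, r.carrier v := by
    intro p hp
    obtain ⟨r, hr, hpr⟩ := hT.covers p
    by_cases hfr : f r = f s
    · exact Or.inl (Set.mem_biUnion (⟨⟨hr, p, hpr, hp⟩, hfr⟩ : r ∈ {r ∈ T₀ | f r = f s}) hpr)
    · exact Or.inr (Set.mem_biUnion (⟨⟨hr, p, hpr, hp⟩, hfr⟩ : r ∈ {r ∈ T₀ | f r ≠ f s}) hpr)
  -- Two finite, hence closed, unions of tiles cover the connected set `B`, so they share a point,
  -- where two tiles with different values of `f` meet.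
  obtain ⟨p, -, hp1, hp2⟩ := isPreconnected_closed_iff.1 hBc _ _
    (hcl _ fun r hr => hr.1) (hcl _ fun r hr => hr.1) hcov
    (by
      obtain ⟨p, hp, hpB⟩ := hsB
      exact ⟨p, hpB, Set.mem_biUnion
        (⟨⟨hs, p, hp, hpB⟩, rfl⟩ : s ∈ {r ∈ T₀ | f r = f s}) hp⟩)
    (by
      obtain ⟨p, hp, hpB⟩ := htB
      exact ⟨p, hpB, Set.mem_biUnion
        (⟨⟨ht, p, hp, hpB⟩, fun h => hne h.symm⟩ : t ∈ {r ∈ T₀ | f r ≠ f s}) hp⟩)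
  simp only [Set.mem_iUnion, Set.mem_ofPred_eq] at hp1 hp2
  obtain ⟨r, ⟨hr, hfr⟩, hpr⟩ := hp1
  obtain ⟨q, ⟨hq, hfq⟩, hpq⟩ := hp2
  exact hfq ((hf q hq.1 r hr.1 hq.2 hr.2 ⟨p, hpq, hpr⟩).trans hfr)

/-- Tiles that meet `B` are shifted in the same way by two lifts of these tiles. -/
theorem IsTiling.lift_sub_eq {T : Set (Tile n d)} (hT : IsTiling v T)
    {B : Set (Fin d → ℝ)} (hB : Bornology.IsBounded B) (hBc : IsPreconnected B)
    {φ φ' : (Fin d → ℝ) → (Fin n → ℤ)}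
    (hφ : IsLift v {t ∈ T | (t.carrier v ∩ B).Nonempty} φ)
    (hφ' : IsLift v {t ∈ T | (t.carrier v ∩ B).Nonempty} φ') {s t : Tile n d}
    (hs : s ∈ T) (ht : t ∈ T) (hsB : (s.carrier v ∩ B).Nonempty)
    (htB : (t.carrier v ∩ B).Nonempty) : φ s.base - φ' s.base = φ t.base - φ' t.base := by
  refine hT.eq_of_isPreconnected hB hBc (f := fun t => φ t.base - φ' t.base) ?_ hs ht hsB htB
  intro s hs t ht hsB htB hst
  obtain ⟨K, hK, L, hL, h⟩ := hT.exists_common_vertex hs ht hst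
  have h1 := hφ s ⟨hs, hsB⟩ K hK
  have h2 := hφ t ⟨ht, htB⟩ L hL
  have h3 := hφ' s ⟨hs, hsB⟩ K hK
  have h4 := hφ' t ⟨ht, htB⟩ L hL
  rw [h] at h1 h3
  have h5 := h1.symm.trans h2
  have h6 := h3.symm.trans h4
  calc φ s.base - φ' s.base
      = (φ s.base + ∑ i ∈ K, Pi.single i 1) - (φ' s.base + ∑ i ∈ K, Pi.single i 1) := by abel
    _ = φ t.base - φ' t.base := by rw [h5, h6]; abel

/-- A lift followed by the projection to `ℝ^d` is a translation. -/
theorem IsTiling.projMap_lift {T : Set (Tile n d)} (hT : IsTiling v T)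
    {φ : (Fin d → ℝ) → (Fin n → ℤ)} (hφ : IsLift v T φ) {s t : Tile n d}
    (hs : s ∈ T) (ht : t ∈ T) :
    projMap v (castVec (φ t.base - φ s.base)) = t.base - s.base := by
  have key : projMap v (castVec (φ s.base)) - s.base = projMap v (castVec (φ t.base)) - t.base := by
    refine hT.eq_of_isPreconnected (B := segment ℝ s.base t.base) ?_
      (convex_segment _ _).isPreconnected
      (f := fun t => projMap v (castVec (φ t.base)) - t.base) ?_ hs ht
      ⟨s.base, base_mem_cell _ _ _, left_mem_segment _ _ _⟩
      ⟨t.base, base_mem_cell _ _ _, right_mem_segment _ _ _⟩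
    · rw [segment_eq_image_lineMap]
      exact (isCompact_Icc.image AffineMap.lineMap_continuous).isBounded
    · intro s hs t ht _ _ hst
      obtain ⟨K, hK, L, hL, h⟩ := hT.exists_common_vertex hs ht hst
      have h1 := hφ s hs K hK
      have h2 := hφ t ht L hL
      rw [h, h2] at h1
      have h3 := congrArg (fun z => projMap v (castVec z)) h1
      simp only [castVec_add, map_add, projMap_castVec_sum_single] at h3
      calc projMap v (castVec (φ s.base)) - s.base
          = projMap v (castVec (φ s.base)) + ∑ i ∈ K, v i - (s.base + ∑ i ∈ K, v i) := by abel
        _ = projMap v (castVec (φ t.base)) - t.base := by rw [← h3, h]; abel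
  rw [castVec_sub, map_sub, sub_eq_sub_iff_add_eq_add]
  rw [sub_eq_sub_iff_add_eq_add] at key
  rw [add_comm t.base, key]

theorem exists_norm_castVec_lift_sub_le {T : Set (Tile n d)} {V : Submodule ℝ (Fin n → ℝ)} {w : ℕ}
    {φ : (Fin d → ℝ) → (Fin n → ℤ)} (hφ : liftSurface T φ ⊆ slice V w) {t : Tile n d}
    (ht : t ∈ T) : ∃ y ∈ V, ‖castVec (φ t.base) - y‖ ≤ w := by
  obtain ⟨y, hy, u, hu, h⟩ := hφ (show castVec (φ t.base) ∈ liftSurface T φ from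
    ⟨t, ht, base_mem_cell _ _ _⟩)
  refine ⟨y, hy, ?_⟩
  rw [h, add_sub_cancel_left]
  refine (pi_norm_le_iff_of_nonneg (Nat.cast_nonneg w)).2 fun i => ?_
  rw [Real.norm_eq_abs, abs_of_nonneg (hu i).1]
  exact (hu i).2.le

/-! ### Coarse linearity -/

/-- Approximating a large multiple of `x` and scaling back shows that `W` is dense; it is also
closed. -/
theorem submodule_eq_top_of_forall_exists_norm_sub_le {E : Type*} [NormedAddCommGroup E]
    [NormedSpace ℝ E] [FiniteDimensional ℝ E] {W : Submodule ℝ E} {C : ℝ}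
    (h : ∀ x, ∃ y ∈ W, ‖x - y‖ ≤ C) : W = ⊤ := by
  rw [eq_top_iff]
  intro x _
  have hcl : IsClosed (W : Set E) := W.closed_of_finiteDimensional
  rw [← SetLike.mem_coe, ← hcl.closure_eq, Metric.mem_closure_iff]
  intro ε hε
  obtain ⟨N, hN⟩ := exists_nat_gt (C / ε)
  obtain ⟨y, hy, hxy⟩ := h ((N + 1 : ℝ) • x)
  have hN0 : (0 : ℝ) < N + 1 := by positivity
  refine ⟨(N + 1 : ℝ)⁻¹ • y, W.smul_mem _ hy, ?_⟩
  have h1 : x - (N + 1 : ℝ)⁻¹ • y = (N + 1 : ℝ)⁻¹ • ((N + 1 : ℝ) • x - y) := by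
    rw [smul_sub, smul_smul, inv_mul_cancel₀ hN0.ne', one_smul]
  rw [dist_eq_norm, h1, norm_smul, norm_inv, Real.norm_of_nonneg hN0.le, inv_mul_lt_iff₀ hN0]
  rw [div_lt_iff₀ hε] at hN
  nlinarith

/-- The slope of a planar tiling projects injectively to `ℝ^d`. -/
theorem eq_zero_of_projMap_eq_zero {T : Set (Tile n d)} (hT : IsTiling v T)
    {V : Submodule ℝ (Fin n → ℝ)} (hV : Module.finrank ℝ V = d) {w : ℕ}
    {φ : (Fin d → ℝ) → (Fin n → ℤ)} (hφ : IsLift v T φ) (hφV : liftSurface T φ ⊆ slice V w) :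
    ∀ y ∈ V, projMap v y = 0 → y = 0 := by
  -- Tiles reach within `tileSize v` of every point and their lifted origins are within `w` of `V`,
  -- so the image of `V` is coarsely dense.
  have htop : LinearMap.range ((projMap v).comp V.subtype) = ⊤ := by
    obtain ⟨t₀, ht₀, -⟩ := hT.covers 0
    obtain ⟨y₀, hy₀, hy₀'⟩ := exists_norm_castVec_lift_sub_le hφV ht₀
    refine submodule_eq_top_of_forall_exists_norm_sub_le
      (C := tileSize v + ‖t₀.base‖ + (tileSize v * w + tileSize v * w)) fun x => ?_
    obtain ⟨t, ht, hxt⟩ := hT.covers x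
    obtain ⟨y, hy, hy'⟩ := exists_norm_castVec_lift_sub_le hφV ht
    refine ⟨projMap v (y - y₀), ⟨⟨y - y₀, V.sub_mem hy hy₀⟩, rfl⟩, ?_⟩
    have h1 := hT.projMap_lift hφ ht₀ ht
    rw [castVec_sub] at h1
    have h2 : x - projMap v (y - y₀) = (x - t.base) + t₀.base +
        (projMap v (castVec (φ t.base) - y) - projMap v (castVec (φ t₀.base) - y₀)) := by
      rw [← map_sub, sub_sub_sub_comm, map_sub _ (castVec (φ t.base) - _), h1]
      abel
    rw [h2]
    refine (norm_add_le _ _).trans (add_le_add ((norm_add_le _ _).trans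
      (add_le_add_left (norm_sub_le_of_mem_cell hxt) _)) ((norm_sub_le _ _).trans (add_le_add ?_ ?_)))
    · exact (norm_projMap_le _).trans (mul_le_mul_of_nonneg_left hy' tileSize_nonneg)
    · exact (norm_projMap_le _).trans (mul_le_mul_of_nonneg_left hy₀' tileSize_nonneg)
  have hinj : Function.Injective ((projMap v).comp V.subtype) :=
    (LinearMap.injective_iff_surjective_of_finrank_eq_finrank (by simp [hV])).2
      (LinearMap.range_eq_top.1 htop)
  intro y hy h
  have := hinj (a₁ := ⟨y, hy⟩) (a₂ := 0) (by simpa using h)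
  exact congrArg Subtype.val this

/-- Lifts of planar tilings are coarsely Lipschitz. -/
theorem exists_norm_lift_sub_le {T : Set (Tile n d)} (hT : IsTiling v T)
    {V : Submodule ℝ (Fin n → ℝ)} {w : ℕ} {φ : (Fin d → ℝ) → (Fin n → ℤ)} (hφ : IsLift v T φ)
    (hφV : liftSurface T φ ⊆ slice V w) (hinj : ∀ y ∈ V, projMap v y = 0 → y = 0) :
    ∃ C : ℝ, 0 ≤ C ∧ ∀ s ∈ T, ∀ t ∈ T,
      ‖castVec (φ t.base - φ s.base)‖ ≤ C * (‖t.base - s.base‖ + 1) := by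
  have hker : LinearMap.ker ((projMap v).comp V.subtype) = ⊥ := by
    rw [LinearMap.ker_eq_bot']
    intro y hy
    exact Subtype.ext (hinj y y.2 hy)
  obtain ⟨c, -, hc⟩ := LinearMap.exists_antilipschitzWith _ hker
  refine ⟨c + (c * (tileSize v * (2 * w)) + 2 * w), by have := tileSize_nonneg (v := v); positivity,
    fun s hs t ht => ?_⟩
  obtain ⟨y, hy, hy'⟩ := exists_norm_castVec_lift_sub_le hφV ht
  obtain ⟨z, hz, hz'⟩ := exists_norm_castVec_lift_sub_le hφV hs
  have h1 := hT.projMap_lift hφ hs ht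
  obtain ⟨q, hq⟩ : ∃ q, q = castVec (φ t.base - φ s.base) := ⟨_, rfl⟩
  rw [← hq] at h1 ⊢
  have h2 : ‖q - (y - z)‖ ≤ 2 * w := by
    rw [hq, castVec_sub, sub_sub_sub_comm]
    exact (norm_sub_le _ _).trans (by linarith)
  have h3 : ‖y - z‖ ≤ c * ‖projMap v (y - z)‖ := by
    have := hc.le_mul_dist ⟨y - z, V.sub_mem hy hz⟩ 0
    simpa [dist_eq_norm] using this
  have h4 : ‖projMap v (y - z)‖ ≤ ‖t.base - s.base‖ + tileSize v * (2 * w) := by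
    have h5 : projMap v (y - z) = (t.base - s.base) - projMap v (q - (y - z)) := by
      rw [map_sub _ q, h1]; abel
    rw [h5]
    exact (norm_sub_le _ _).trans (add_le_add_right ((norm_projMap_le _).trans
      (mul_le_mul_of_nonneg_left h2 tileSize_nonneg)) _)
  have h6 : ‖q‖ ≤ ‖y - z‖ + ‖q - (y - z)‖ := by
    have := norm_add_le (y - z) (q - (y - z))
    rwa [add_sub_cancel] at this
  have h7 := mul_le_mul_of_nonneg_left h4 c.2
  have h8 : 0 ≤ (c * (tileSize v * (2 * w)) + 2 * w) * ‖t.base - s.base‖ := by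
    have := tileSize_nonneg (v := v); positivity
  simp only [NNReal.val_eq_coe] at h7
  nlinarith

theorem norm_sub_le_latticeNorm {E : Type*} [SeminormedAddCommGroup E] {f : (Fin d → ℤ) → E}
    {L : ℝ} (hf : ∀ g l, ‖f (g + Pi.single l 1) - f g‖ ≤ L) (g h : Fin d → ℤ) :
    ‖f h - f g‖ ≤ L * latticeNorm (h - g) := by
  obtain ⟨m, hm⟩ : ∃ m, latticeNorm (h - g) = m := ⟨_, rfl⟩
  induction m generalizing h with
  | zero =>
    have : h - g = 0 := by
      ext l
      simpa using (Finset.sum_eq_zero_iff.1 hm) l (Finset.mem_univ l)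
    rw [sub_eq_zero.1 this]
    simp [latticeNorm]
  | succ m ih =>
    obtain ⟨l, ε, hε, hl⟩ := exists_latticeNorm_add_single hm
    have h1 : h - g + Pi.single l ε = h + Pi.single l ε - g := by abel
    have h2 := ih (h + Pi.single l ε) (by rw [← h1]; exact hl)
    have h3 : ‖f h - f (h + Pi.single l ε)‖ ≤ L := by
      rcases hε with rfl | rfl
      · rw [norm_sub_rev]; exact hf _ _
      · have := hf (h + Pi.single l (-1)) l
        rwa [add_assoc, ← Pi.single_add, neg_add_cancel, Pi.single_zero, add_zero] at this
    rw [← h1, hl] at h2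
    rw [hm]
    push_cast
    calc ‖f h - f g‖ ≤ ‖f h - f (h + Pi.single l ε)‖ + ‖f (h + Pi.single l ε) - f g‖ :=
          norm_sub_le_norm_sub_add_norm_sub _ _ _
      _ ≤ L * (m + 1) := by linarith

theorem latticeNorm_le (g : Fin d → ℤ) : (latticeNorm g : ℝ) ≤ d * ‖castVec g‖ := by
  unfold latticeNorm
  push_cast
  refine (Finset.sum_le_card_nsmul _ _ ‖castVec g‖ fun l _ => ?_).trans (by simp)
  have := norm_le_pi_norm (castVec g) l
  simpa [castVec, Nat.cast_natAbs] using this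

theorem latticeNorm_single (l : Fin d) (r : ℕ) : latticeNorm (Pi.single l (r : ℤ)) = r := by
  unfold latticeNorm
  rw [Finset.sum_eq_single l]
  · simp
  · intro b _ hb
    simp [Pi.single_eq_of_ne hb]
  · simp

theorem castVec_single (l : Fin d) (r : ℤ) :
    castVec (Pi.single l r) = (r : ℝ) • Pi.single l (1 : ℝ) := by
  ext j
  by_cases h : j = l
  · subst h; simp [castVec]
  · simp [castVec, Pi.single_eq_of_ne h]

/-- A map from `ℤ^d` to `ℝ^d` close enough to a homothety at small scale is so at all scales. -/
theorem norm_sub_sub_smul_le {u : (Fin d → ℤ) → (Fin d → ℝ)} {δ η : ℝ}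
    (hu : ∀ g l, ‖u (g + Pi.single l 1) - u g - δ • Pi.single l (1 : ℝ)‖ ≤ η) (g h : Fin d → ℤ) :
    ‖u h - u g - δ • castVec (h - g)‖ ≤ η * latticeNorm (h - g) := by
  have h1 := norm_sub_le_latticeNorm (f := fun g => u g - δ • castVec g) (L := η) (fun g l => by
    have h2 : u (g + Pi.single l 1) - δ • castVec (g + Pi.single l 1) - (u g - δ • castVec g) =
        u (g + Pi.single l 1) - u g - δ • Pi.single l (1 : ℝ) := by
      rw [castVec_add, castVec_single]
      simp only [Int.cast_one, one_smul, smul_add]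
      abel
    rw [h2]; exact hu g l) g h
  have h3 : u h - u g - δ • castVec (h - g) =
      (u h - δ • castVec h) - (u g - δ • castVec g) := by
    rw [castVec_sub, smul_sub]; abel
  rwa [h3]

/-- Moving `g` by the rounding of `(x - u g) / δ` turns a distance `D` into at most `D / 2 + 3 δ /
4`, a gain of at least `δ / 4` as long as `D > 2 δ`. This makes the patches of radius `2 δ` cover
the space. -/
theorem exists_norm_sub_le_two_mul {u : (Fin d → ℤ) → (Fin d → ℝ)} {δ : ℝ} (hδ : 0 < δ)
    (hu : ∀ g h, ‖u h - u g - δ • castVec (h - g)‖ ≤ δ / 2 * ‖castVec (h - g)‖) (x : Fin d → ℝ) :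
    ∃ g, ‖x - u g‖ ≤ 2 * δ := by
  have step : ∀ m : ℕ, ∀ g, ‖x - u g‖ ≤ 2 * δ + m * (δ / 4) → ∃ g, ‖x - u g‖ ≤ 2 * δ := by
    intro m
    induction m with
    | zero => intro g hg; exact ⟨g, by simpa using hg⟩
    | succ m ih =>
      intro g hg
      by_cases h2 : ‖x - u g‖ ≤ 2 * δ
      · exact ⟨g, h2⟩
      let k : Fin d → ℤ := fun l => round ((x - u g) l / δ)
      have hk : ‖x - u g - δ • castVec k‖ ≤ δ / 2 := by
        refine (pi_norm_le_iff_of_nonneg (by positivity)).2 fun l => ?_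
        have h1 := abs_sub_round ((x - u g) l / δ)
        have h2 : (x - u g - δ • castVec k) l =
            δ * ((x - u g) l / δ - round ((x - u g) l / δ)) := by
          simp only [Pi.sub_apply, Pi.smul_apply, castVec, smul_eq_mul, k, mul_sub]
          rw [mul_div_cancel₀ _ hδ.ne']
        rw [h2, Real.norm_eq_abs, abs_mul, abs_of_pos hδ]
        nlinarith
      have hk' : δ * ‖castVec k‖ ≤ ‖x - u g‖ + δ / 2 := by
        have h1 := norm_sub_norm_le (δ • castVec k) (δ • castVec k - (x - u g))
        rw [sub_sub_cancel, norm_smul, Real.norm_of_nonneg hδ.le, norm_sub_rev] at h1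
        linarith
      have hg' := hu g (g + k)
      rw [add_sub_cancel_left] at hg'
      refine ih (g + k) ?_
      have h3 : x - u (g + k) = (x - u g - δ • castVec k) - (u (g + k) - u g - δ • castVec k) := by
        abel
      have h4 := norm_sub_le (x - u g - δ • castVec k) (u (g + k) - u g - δ • castVec k)
      rw [← h3] at h4
      push_cast at hg
      push Not at h2
      linarith
  obtain ⟨m, hm⟩ := exists_nat_ge (‖x - u 0‖ / (δ / 4))
  rw [div_le_iff₀ (by positivity)] at hm
  exact step m 0 (by linarith)

/-! ### Configurations of patches and the tilings they define -/

variable {k : ℕ}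

/-- The translate of a tile. -/
def Tile.shift (t : Tile n d) (a : Fin d → ℝ) : Tile n d := ⟨t.base + a, t.idx⟩

theorem Tile.shift_shift (t : Tile n d) (a b : Fin d → ℝ) :
    (t.shift a).shift b = t.shift (a + b) := by
  simp [Tile.shift, add_assoc]

theorem Tile.shift_zero (t : Tile n d) : t.shift 0 = t := by simp [Tile.shift]

theorem Tile.shift_injective (a : Fin d → ℝ) :
    Function.Injective fun t : Tile n d => t.shift a := by
  intro s t h
  have := congrArg (fun t : Tile n d => t.shift (-a)) h
  simpa [Tile.shift_shift, Tile.shift_zero] using this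

theorem Tile.mem_carrier_shift {t : Tile n d} {a p : Fin d → ℝ} :
    p ∈ (t.shift a).carrier v ↔ p - a ∈ t.carrier v :=
  mem_cell_translate _ _ _ _ _

theorem Tile.base_mem_carrier (t : Tile n d) : t.base ∈ t.carrier v := base_mem_cell _ _ _

theorem Tile.carrier_shift_inter (s t : Tile n d) (a : Fin d → ℝ) :
    (s.shift a).carrier v ∩ (t.shift a).carrier v =
      (fun p => p - a) ⁻¹' (s.carrier v ∩ t.carrier v) := by
  ext p
  simp only [Set.mem_inter_iff, Tile.mem_carrier_shift, Set.mem_preimage]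

theorem Tile.IsProperFace.shift {t : Tile n d} {F : Set (Fin d → ℝ)} (h : t.IsProperFace v F)
    (a : Fin d → ℝ) : (t.shift a).IsProperFace v ((fun p => p - a) ⁻¹' F) := by
  obtain ⟨J, K, hJ, hK, rfl⟩ := h
  refine ⟨J, K, hJ, hK, ?_⟩
  ext p
  rw [Set.mem_preimage, ← mem_cell_translate]
  simp only [Tile.shift, add_right_comm]

/-- The colored tiles `s`, `t` may occur in the same tiling allowed by the rules `R`. -/
def Compatible (v : Fin n → Fin d → ℝ) (R : Set (Rule n d k)) (s t : Tile n d) (a b : Fin k) :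
    Prop :=
  (s.carrier v ∩ t.carrier v).Nonempty → (s = t → a = b) ∧
    (s ≠ t → (s.IsProperFace v (s.carrier v ∩ t.carrier v) ∧
      t.IsProperFace v (s.carrier v ∩ t.carrier v)) ∧
      ((s.idx, a), (t.idx, b), t.base - s.base) ∈ R)

theorem Compatible.shift {R : Set (Rule n d k)} {s t : Tile n d} {a b : Fin k}
    (h : Compatible v R s t a b) (x : Fin d → ℝ) :
    Compatible v R (s.shift x) (t.shift x) a b := by
  intro hne
  rw [Tile.carrier_shift_inter] at hne ⊢
  obtain ⟨p, hp⟩ := hne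
  obtain ⟨h1, h2⟩ := h ⟨_, hp⟩
  refine ⟨fun he => h1 (Tile.shift_injective x he), fun he => ?_⟩
  obtain ⟨⟨h3, h4⟩, h5⟩ := h2 fun he' => he (he' ▸ rfl)
  refine ⟨⟨h3.shift x, h4.shift x⟩, ?_⟩
  simpa [Tile.shift] using h5

/-- A lifted colored tile: the lift of its origin, its generating vectors and its color. -/
abbrev LiftedTile (n k : ℕ) := (Fin n → ℤ) × Finset (Fin n) × Fin k

/-- The projection of a lifted tile. -/
noncomputable def LiftedTile.tile (v : Fin n → Fin d → ℝ) (t : LiftedTile n k) : Tile n d :=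
  ⟨projMap v (castVec t.1), t.2.1⟩

/-- A patch of lifted tiles around the origin that covers the ball of radius `2 δ`, and all the
lifts of which are the given one up to a translation. -/
structure IsPatch (v : Fin n → Fin d → ℝ) (δ : ℝ) (P : Finset (LiftedTile n k)) : Prop where
  origin : ∃ I c, (0, I, c) ∈ P
  valid : ∀ t ∈ P, (LiftedTile.tile v t).IsValid v
  covers : ∀ p, ‖p‖ ≤ 2 * δ → ∃ t ∈ P, p ∈ (LiftedTile.tile v t).carrier v
  size : ∀ t ∈ P, ‖(LiftedTile.tile v t).base‖ ≤ 2 * δ + tileSize v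
  rigid : ∀ φ, IsLift v {r | ∃ t ∈ P, r = LiftedTile.tile v t} φ →
    ∀ t ∈ P, φ (LiftedTile.tile v t).base = φ 0 + t.1

/-- The differences of sites between which there are constraints. -/
def siteBox (d : ℕ) : Set (Fin d → ℤ) := Set.Icc (fun _ => -10) (fun _ => 10)

/-- The local constraints on configurations of patches. -/
def patchTable (v : Fin n → Fin d → ℝ) (R : Set (Rule n d k)) (δ : ℝ) (C : ℤ) :
    Set ((Fin d → ℤ) × (Fin n → ℤ) × Finset (LiftedTile n k) × Finset (LiftedTile n k)) :=
  {x | x.1 ∈ siteBox d ∧ x.2.1 ∈ Set.Icc (fun _ => -C) (fun _ => C) ∧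
    (∀ t ∈ x.2.2.1, t.1 ∈ Set.Icc (fun _ => -C) (fun _ => C)) ∧
    (∀ t ∈ x.2.2.2, t.1 ∈ Set.Icc (fun _ => -C) (fun _ => C)) ∧
    IsPatch v δ x.2.2.1 ∧
    (∀ s ∈ x.2.2.1, ∀ t ∈ x.2.2.2, Compatible v R (LiftedTile.tile v s)
      ((LiftedTile.tile v t).shift (projMap v (castVec x.2.1))) s.2.2 t.2.2) ∧
    -- The norm bound makes positions follow `δ g`. The membership places the origin of the next
    -- site in the current patch, so that rigidity transports lifts from site to site.
    ∀ l, x.1 = Pi.single l 1 →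
      ‖projMap v (castVec x.2.1) - δ • Pi.single l (1 : ℝ)‖ ≤ 2 * tileSize v ∧
      ∃ I c, (x.2.1, I, c) ∈ x.2.2.1}

theorem finite_siteBox (d : ℕ) : (siteBox d).Finite := Set.finite_Icc _ _

theorem single_mem_siteBox (l : Fin d) : (Pi.single l 1 : Fin d → ℤ) ∈ siteBox d := by
  constructor <;> intro i <;> by_cases h : i = l
  · subst h; simp
  · simp [Pi.single_eq_of_ne h]
  · subst h; simp
  · simp [Pi.single_eq_of_ne h]

/-- Lifts have integer coordinates bounded by `C`; the conditions over `ℝ` only select among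
finitely many entries. -/
theorem finite_patchTable (R : Set (Rule n d k)) (δ : ℝ) (C : ℤ) :
    (patchTable v R δ C).Finite := by
  have hZ : (Set.Icc (fun _ => -C) (fun _ => C) : Set (Fin n → ℤ)).Finite := Set.finite_Icc _ _
  have hL : {t : LiftedTile n k | t.1 ∈ Set.Icc (fun _ => -C) (fun _ => C)}.Finite := by
    refine (hZ.prod (Set.finite_univ (α := Finset (Fin n) × Fin k))).subset fun t ht => ⟨ht, trivial⟩
  have hP : {P : Finset (LiftedTile n k) |
      ∀ t ∈ P, t.1 ∈ Set.Icc (fun _ => -C) (fun _ => C)}.Finite := by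
    refine (hL.toFinset.powerset.finite_toSet).subset fun P hP => ?_
    simp only [Finset.coe_powerset, Set.mem_preimage, Set.mem_powerset_iff]
    intro t ht
    simpa using hP t ht
  refine ((finite_siteBox d).prod (hZ.prod (hP.prod hP))).subset ?_
  rintro ⟨x, y, P, Q⟩ ⟨h1, h2, h3, h4, -⟩
  exact ⟨h1, h2, h3, h4⟩

section config

variable {R : Set (Rule n d k)} {δ : ℝ} {C : ℤ} {ψ : (Fin d → ℤ) → (Fin n → ℤ)}
  {σ : (Fin d → ℤ) → Finset (LiftedTile n k)}

/-- The tiles of a configuration of patches. -/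
def configTiles (v : Fin n → Fin d → ℝ) (ψ : (Fin d → ℤ) → (Fin n → ℤ))
    (σ : (Fin d → ℤ) → Finset (LiftedTile n k)) : Set (Tile n d) :=
  {r | ∃ g, ∃ t ∈ σ g, r = (LiftedTile.tile v t).shift (projMap v (castVec (ψ g)))}

theorem IsConfig.isPatch (h : IsConfig (siteBox d) (patchTable v R δ C) ψ σ) (hd : 0 < d)
    (g : Fin d → ℤ) : IsPatch v δ (σ g) :=
  (h.2 g (g + Pi.single ⟨0, hd⟩ 1) (by simpa using single_mem_siteBox _)).2.2.2.2.1

theorem IsConfig.step (h : IsConfig (siteBox d) (patchTable v R δ C) ψ σ) (g : Fin d → ℤ)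
    (l : Fin d) :
    ‖projMap v (castVec (ψ (g + Pi.single l 1) - ψ g)) - δ • Pi.single l (1 : ℝ)‖ ≤
      2 * tileSize v ∧ ∃ I c, (ψ (g + Pi.single l 1) - ψ g, I, c) ∈ σ g :=
  (h.2 g (g + Pi.single l 1) (by simpa using single_mem_siteBox _)).2.2.2.2.2.2 l
    (add_sub_cancel_left _ _)

theorem IsConfig.norm_drift_le (h : IsConfig (siteBox d) (patchTable v R δ C) ψ σ)
    (g g' : Fin d → ℤ) :
    ‖projMap v (castVec (ψ g')) - projMap v (castVec (ψ g)) - δ • castVec (g' - g)‖ ≤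
      2 * tileSize v * latticeNorm (g' - g) :=
  norm_sub_sub_smul_le (u := fun g => projMap v (castVec (ψ g))) (fun g l => by
    have := (h.step g l).1
    rwa [castVec_sub, map_sub] at this) g g'

/-- The factor `4 * d` in `δ` absorbs the drift per step and the passage from the `ℓ¹` norm to the
sup norm. -/
theorem IsConfig.norm_drift_le' (h : IsConfig (siteBox d) (patchTable v R δ C) ψ σ)
    (hδ : δ = 4 * d * tileSize v) (g g' : Fin d → ℤ) :
    ‖projMap v (castVec (ψ g')) - projMap v (castVec (ψ g)) - δ • castVec (g' - g)‖ ≤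
      δ / 2 * ‖castVec (g' - g)‖ := by
  refine (h.norm_drift_le g g').trans ?_
  have h1 := mul_le_mul_of_nonneg_left (latticeNorm_le (g' - g))
    (show 0 ≤ 2 * tileSize v by have := tileSize_nonneg (v := v); positivity)
  refine h1.trans (le_of_eq ?_)
  rw [hδ]; ring

/-- If the tiles meet, their sites are at positions at distance at most `4 δ + 4 * tileSize v ≤ 5
δ`. As positions drift by at most half, the sites differ by at most `10`, so the table constrains
them. -/
theorem IsConfig.compatible (h : IsConfig (siteBox d) (patchTable v R δ C) ψ σ) (hd : 0 < d)
    (hδ : δ = 4 * d * tileSize v) (hv : 0 < tileSize v) {g g' : Fin d → ℤ} {s t : LiftedTile n k}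
    (hs : s ∈ σ g) (ht : t ∈ σ g') :
    Compatible v R ((LiftedTile.tile v s).shift (projMap v (castVec (ψ g))))
      ((LiftedTile.tile v t).shift (projMap v (castVec (ψ g')))) s.2.2 t.2.2 := by
  intro hne
  have hd1 : (1 : ℝ) ≤ d := by exact_mod_cast hd
  have hδ4 : 4 * tileSize v ≤ δ := by rw [hδ]; nlinarith
  set x := projMap v (castVec (ψ g)) with hx
  set x' := projMap v (castVec (ψ g')) with hx'
  have hclose : ‖x' - x‖ ≤ 5 * δ := by
    obtain ⟨p, hp, hp'⟩ := hne
    have h1 := norm_sub_le_of_mem_cell hp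
    have h2 := norm_sub_le_of_mem_cell hp'
    have h3 := (h.isPatch hd g).size s hs
    have h4 := (h.isPatch hd g').size t ht
    simp only [Tile.shift] at h1 h2
    have h5 : x' - x = (p - ((LiftedTile.tile v s).base + x)) + (LiftedTile.tile v s).base -
        ((p - ((LiftedTile.tile v t).base + x')) + (LiftedTile.tile v t).base) := by abel
    rw [h5]
    refine (norm_sub_le _ _).trans ?_
    have h6 := norm_add_le (p - ((LiftedTile.tile v s).base + x)) (LiftedTile.tile v s).base
    have h7 := norm_add_le (p - ((LiftedTile.tile v t).base + x')) (LiftedTile.tile v t).base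
    linarith
  have hbox : g' - g ∈ siteBox d := by
    have h1 := h.norm_drift_le' hδ g g'
    rw [← hx, ← hx'] at h1
    have h2 := norm_sub_norm_le (δ • castVec (g' - g)) (x' - x)
    rw [norm_sub_rev (δ • _), norm_smul, Real.norm_of_nonneg (show 0 ≤ δ by linarith)] at h2
    have h3 : ‖castVec (g' - g)‖ ≤ 10 := by
      have : δ * ‖castVec (g' - g)‖ ≤ δ * 10 := by linarith
      exact le_of_mul_le_mul_left this (by linarith)
    have h4 : ∀ l, |(g' - g) l| ≤ 10 := fun l => by
      have := (norm_le_pi_norm (castVec (g' - g)) l).trans h3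
      rw [castVec, Real.norm_eq_abs] at this
      exact_mod_cast this
    exact ⟨fun l => (abs_le.1 (h4 l)).1, fun l => (abs_le.1 (h4 l)).2⟩
  have h1 := ((h.2 g g' hbox).2.2.2.2.2.1 s hs t ht).shift x
  rw [Tile.shift_shift, castVec_sub, map_sub, sub_add_cancel] at h1
  exact h1 hne

theorem IsConfig.exists_isAllowed (h : IsConfig (siteBox d) (patchTable v R δ C) ψ σ)
    (hd : 0 < d) (hδ : δ = 4 * d * tileSize v) (hv : 0 < tileSize v) :
    ∃ c, IsAllowed v R (configTiles v ψ σ) c := by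
  classical
  obtain ⟨I₀, c₀, -⟩ := (h.isPatch hd 0).origin
  -- A tile may occur in several patches; `Compatible` forces its color to be the same in all of
  -- them.
  let c : Tile n d → Fin k := fun r =>
    if hr : r ∈ configTiles v ψ σ then hr.choose_spec.choose.2.2 else c₀
  have hc : ∀ g, ∀ t ∈ σ g,
      c ((LiftedTile.tile v t).shift (projMap v (castVec (ψ g)))) = t.2.2 := by
    intro g t ht
    have hr : (LiftedTile.tile v t).shift (projMap v (castVec (ψ g))) ∈ configTiles v ψ σ :=
      ⟨g, t, ht, rfl⟩
    simp only [c, dif_pos hr]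
    have h1 := hr.choose_spec.choose_spec
    have h2 := h.compatible hd hδ hv h1.1 ht
    rw [← h1.2] at h2
    exact (h2 ⟨_, Tile.base_mem_carrier _, Tile.base_mem_carrier _⟩).1 rfl
  have hδ0 : 0 < δ := by
    have : (0 : ℝ) < d := by exact_mod_cast hd
    rw [hδ]; positivity
  have key : ∀ s ∈ configTiles v ψ σ, ∀ t ∈ configTiles v ψ σ, Compatible v R s t (c s) (c t) := by
    rintro _ ⟨g, s, hs, rfl⟩ _ ⟨g', t, ht, rfl⟩
    rw [hc g s hs, hc g' t ht]
    exact h.compatible hd hδ hv hs ht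
  refine ⟨c, ⟨⟨?_, ?_, ?_⟩, ?_⟩⟩
  · rintro _ ⟨g, t, ht, rfl⟩
    exact (h.isPatch hd g).valid t ht
  · intro p
    obtain ⟨g, hg⟩ := exists_norm_sub_le_two_mul hδ0 (h.norm_drift_le' hδ) p
    obtain ⟨t, ht, hp⟩ := (h.isPatch hd g).covers _ hg
    exact ⟨_, ⟨g, t, ht, rfl⟩, Tile.mem_carrier_shift.2 hp⟩
  · exact fun s hs t ht hst hne => ((key s hs t ht hne).2 hst).1
  · exact fun s hs t ht hst hne => ((key s hs t ht hne).2 hst).2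

/-- By rigidity of the patch at `g`, which contains the origin of the next site, the lift minus `ψ`
does not change along unit steps. -/
theorem IsConfig.lift_eq (h : IsConfig (siteBox d) (patchTable v R δ C) ψ σ) (hd : 0 < d)
    {φ : (Fin d → ℝ) → (Fin n → ℤ)} (hφ : IsLift v (configTiles v ψ σ) φ) (g : Fin d → ℤ) :
    ψ g = φ (projMap v (castVec (ψ g))) - φ 0 := by
  have hrigid : ∀ g, ∀ t ∈ σ g, φ ((LiftedTile.tile v t).base + projMap v (castVec (ψ g))) =
      φ (projMap v (castVec (ψ g))) + t.1 := by
    intro g t ht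
    have h1 := (h.isPatch hd g).rigid (fun x => φ (x + projMap v (castVec (ψ g)))) (by
      rintro _ ⟨t, ht, rfl⟩ K hK
      have := hφ _ ⟨g, t, ht, rfl⟩ K hK
      rwa [Tile.shift, add_right_comm] at this) t ht
    simpa using h1
  have hstep : ∀ g l, ‖castVec (φ (projMap v (castVec (ψ (g + Pi.single l 1)))) -
      ψ (g + Pi.single l 1)) - castVec (φ (projMap v (castVec (ψ g))) - ψ g)‖ ≤ 0 := by
    intro g l
    obtain ⟨-, I, c, hIc⟩ := h.step g l
    have h1 := hrigid g _ hIc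
    simp only [LiftedTile.tile, castVec_sub, map_sub, sub_add_cancel] at h1
    rw [← castVec_sub, h1]
    have : φ (projMap v (castVec (ψ g))) + (ψ (g + Pi.single l 1) - ψ g) -
        ψ (g + Pi.single l 1) - (φ (projMap v (castVec (ψ g))) - ψ g) = 0 := by abel
    rw [this, castVec_zero, norm_zero]
  have h2 := norm_sub_le_latticeNorm
    (f := fun g => castVec (φ (projMap v (castVec (ψ g))) - ψ g)) hstep 0 g
  rw [zero_mul, norm_le_zero_iff, ← castVec_sub, h.1, castVec_zero, map_zero, sub_zero] at h2
  have h3 : φ (projMap v (castVec (ψ g))) - ψ g - φ 0 = 0 := by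
    ext i
    have := congrFun h2 i
    simp only [castVec, Pi.zero_apply, Pi.sub_apply] at this ⊢
    exact_mod_cast this
  rw [sub_sub, sub_eq_zero] at h3
  rw [h3]; abel

/-- The width is counted twice because the normalization `ψ 0 = 0` subtracts one lifted point from
another. -/
theorem IsConfig.exists_norm_sub_le (h : IsConfig (siteBox d) (patchTable v R δ C) ψ σ)
    (hd : 0 < d) {V : Submodule ℝ (Fin n → ℝ)} {w : ℕ}
    (hT : IsPlanarOfWidthLE v (configTiles v ψ σ) V w) (g : Fin d → ℤ) :
    ∃ y ∈ V, ‖castVec (ψ g) - y‖ ≤ 2 * w := by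
  obtain ⟨φ, hφ, hφV⟩ := hT.lifts
  have hnear : ∀ g, ∃ y ∈ V, ‖castVec (φ (projMap v (castVec (ψ g)))) - y‖ ≤ w := by
    intro g
    obtain ⟨I, c, hI⟩ := (h.isPatch hd g).origin
    have := exists_norm_castVec_lift_sub_le hφV (t := _) ⟨g, _, hI, rfl⟩
    simpa [Tile.shift, LiftedTile.tile, castVec_zero] using this
  obtain ⟨y, hy, hy'⟩ := hnear g
  obtain ⟨z, hz, hz'⟩ := hnear 0
  rw [h.1, castVec_zero, map_zero] at hz'
  refine ⟨y - z, V.sub_mem hy hz, ?_⟩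
  rw [h.lift_eq hd hφ g, castVec_sub, sub_sub_sub_comm]
  refine (norm_sub_le _ _).trans ?_
  linarith

theorem IsConfig.norm_single_le (h : IsConfig (siteBox d) (patchTable v R δ C) ψ σ) (hC : 0 ≤ C)
    (r : ℕ) (l : Fin d) : ‖castVec (ψ (Pi.single l (r : ℤ)))‖ ≤ C * r := by
  have h1 := norm_sub_le_latticeNorm (f := fun g => castVec (ψ g)) (L := C) (fun g l => by
    have h2 := (h.2 g (g + Pi.single l 1) (by simpa using single_mem_siteBox l)).2.1
    rw [← castVec_sub]
    refine (pi_norm_le_iff_of_nonneg (by exact_mod_cast hC)).2 fun i => ?_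
    rw [castVec, Real.norm_eq_abs]
    have := abs_le.2 ⟨h2.1 i, h2.2 i⟩
    exact_mod_cast this) 0 (Pi.single l (r : ℤ))
  rwa [h.1, castVec_zero, sub_zero, sub_zero, latticeNorm_single] at h1

end config

/-! ### From allowed tilings to configurations -/

theorem IsTiling.tileSize_pos {T : Set (Tile n d)} (hT : IsTiling v T) (hd : 0 < d) :
    0 < tileSize v := by
  obtain ⟨t, ht, -⟩ := hT.covers 0
  obtain ⟨hcard, hli⟩ := hT.valid t ht
  obtain ⟨i, hi⟩ := Finset.card_pos.1 (hcard ▸ hd)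
  exact (norm_pos_iff.2 (hli.ne_zero (Finset.mem_coe.2 hi))).trans_le
    (Finset.single_le_sum (f := fun i => ‖v i‖) (fun _ _ => norm_nonneg _) (Finset.mem_univ i))

section patch

variable {T : Set (Tile n d)} {R : Set (Rule n d k)} {c : Tile n d → Fin k}
  {φ : (Fin d → ℝ) → (Fin n → ℤ)} {δ : ℝ}

/-- The tiles of `T` that meet the ball of radius `2 δ` around `b`. -/
def tilesNear (v : Fin n → Fin d → ℝ) (T : Set (Tile n d)) (δ : ℝ) (b : Fin d → ℝ) :
    Set (Tile n d) :=
  {t ∈ T | (t.carrier v ∩ Metric.closedBall b (2 * δ)).Nonempty}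

/-- The tile `t`, lifted by `φ` and seen from `b`. -/
def liftTile (φ : (Fin d → ℝ) → (Fin n → ℤ)) (c : Tile n d → Fin k) (b : Fin d → ℝ)
    (t : Tile n d) : LiftedTile n k :=
  (φ t.base - φ b, t.idx, c t)

theorem IsTiling.tile_liftTile (hT : IsTiling v T) (hφ : IsLift v T φ) {s t : Tile n d}
    (hs : s ∈ T) (ht : t ∈ T) :
    LiftedTile.tile v (liftTile φ c s.base t) = t.shift (-s.base) := by
  simp only [LiftedTile.tile, liftTile, Tile.shift, hT.projMap_lift hφ hs ht]
  rw [sub_eq_add_neg]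

theorem norm_base_sub_le_of_mem_tilesNear {b : Fin d → ℝ} {t : Tile n d}
    (ht : t ∈ tilesNear v T δ b) : ‖t.base - b‖ ≤ 2 * δ + tileSize v := by
  obtain ⟨-, p, hp, hpb⟩ := ht
  have h1 := norm_sub_le_of_mem_cell hp
  have h2 := mem_closedBall_iff_norm.1 hpb
  have h3 := norm_sub_le (p - b) (p - t.base)
  rw [sub_sub_sub_cancel_left] at h3
  linarith

/-- Rigidity comes from `IsTiling.lift_sub_eq` applied to the closed ball, which is convex and hence
connected. -/
theorem IsTiling.isPatch (hT : IsTiling v T) (hφ : IsLift v T φ) (hδ : 0 ≤ δ) {s : Tile n d}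
    (hs : s ∈ T) {P : Finset (LiftedTile n k)}
    (hP : ∀ x, x ∈ P ↔ ∃ t ∈ tilesNear v T δ s.base, liftTile φ c s.base t = x) :
    IsPatch v δ P := by
  have hs' : s ∈ tilesNear v T δ s.base :=
    ⟨hs, s.base, s.base_mem_carrier, Metric.mem_closedBall_self (by positivity)⟩
  refine ⟨⟨s.idx, c s, (hP _).2 ⟨s, hs', by simp [liftTile]⟩⟩, ?_, ?_, ?_, ?_⟩
  · intro x hx
    obtain ⟨t, ht, rfl⟩ := (hP _).1 hx
    exact hT.valid t ht.1
  · intro p hp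
    obtain ⟨t, ht, hpt⟩ := hT.covers (p + s.base)
    refine ⟨_, (hP _).2 ⟨t, ⟨ht, _, hpt, by simpa [mem_closedBall_iff_norm] using hp⟩, rfl⟩, ?_⟩
    rw [hT.tile_liftTile hφ hs ht, Tile.mem_carrier_shift, sub_neg_eq_add]
    exact hpt
  · intro x hx
    obtain ⟨t, ht, rfl⟩ := (hP _).1 hx
    rw [hT.tile_liftTile hφ hs ht.1, Tile.shift, ← sub_eq_add_neg]
    exact norm_base_sub_le_of_mem_tilesNear ht
  · intro φ' hφ' x hx
    obtain ⟨t, ht, rfl⟩ := (hP _).1 hx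
    have h1 : IsLift v (tilesNear v T δ s.base) fun x => φ' (x - s.base) := by
      intro r hr K hK
      have := hφ' (r.shift (-s.base))
        ⟨_, (hP _).2 ⟨r, hr, rfl⟩, (hT.tile_liftTile hφ hs hr.1).symm⟩ K hK
      simp only [Tile.shift] at this
      rwa [add_right_comm, ← sub_eq_add_neg, ← sub_eq_add_neg] at this
    have h2 := hT.lift_sub_eq Metric.isBounded_closedBall
      (convex_closedBall s.base (2 * δ)).isPreconnected (fun r hr => hφ r hr.1) h1 hs ht.1
      hs'.2 ht.2
    rw [hT.tile_liftTile hφ hs ht.1, Tile.shift, ← sub_eq_add_neg]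
    simp only [sub_self] at h2
    simp only [liftTile]
    rw [sub_eq_sub_iff_add_eq_add] at h2
    rw [← add_sub_assoc, add_comm (φ' 0), ← h2]
    abel

theorem IsAllowed.compatible (hT : IsAllowed v R T c) {s t : Tile n d} (hs : s ∈ T) (ht : t ∈ T) :
    Compatible v R s t (c s) (c t) := fun hne =>
  ⟨fun h => by rw [h], fun h => ⟨hT.tiling.face_to_face s hs t ht h hne, hT.rules s hs t ht h hne⟩⟩

/-- Allowed planar tilings yield configurations of patches. -/
theorem IsAllowed.exists_isConfig (hT : IsAllowed v R T c) (hd : 0 < d)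
    (hδ : δ = 4 * d * tileSize v) (hφ : IsLift v T φ) {C₀ : ℝ} (hC₀ : 0 ≤ C₀)
    (hC : ∀ s ∈ T, ∀ t ∈ T, ‖castVec (φ t.base - φ s.base)‖ ≤ C₀ * (‖t.base - s.base‖ + 1)) :
    ∃ C : ℤ, 0 ≤ C ∧ ∃ ψ σ, IsConfig (siteBox d) (patchTable v R δ C) ψ σ := by
  classical
  have hpos := hT.tiling.tileSize_pos hd
  have hd1 : (1 : ℝ) ≤ d := by exact_mod_cast hd
  have hδ4 : 4 * tileSize v ≤ δ := by rw [hδ]; nlinarith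
  have hδ0 : 0 ≤ δ := by linarith
  choose t ht hgt using fun g : Fin d → ℤ => hT.tiling.covers (δ • castVec g)
  have hfin : ∀ g, (tilesNear v T δ (t g).base).Finite := fun g =>
    hT.tiling.finite_meeting Metric.isBounded_closedBall
  let σ : (Fin d → ℤ) → Finset (LiftedTile n k) := fun g =>
    (hfin g).toFinset.image (liftTile φ c (t g).base)
  have hσ : ∀ g x, x ∈ σ g ↔ ∃ r ∈ tilesNear v T δ (t g).base, liftTile φ c (t g).base r = x := by
    intro g x
    simp [σ]
  -- Origins of sites that differ by at most `10` are within `10 δ + 2 * tileSize v`, and patches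
  -- have radius `2 δ + tileSize v`; both are below `11 δ`.
  let C : ℤ := ⌈C₀ * (11 * δ + 1)⌉
  have hCle : C₀ * (11 * δ + 1) ≤ C := Int.le_ceil _
  have hmem : ∀ r ∈ T, ∀ s ∈ T, ‖s.base - r.base‖ ≤ 11 * δ →
      φ s.base - φ r.base ∈ Set.Icc (fun _ => -C) (fun _ => C) := by
    intro r hr s hs hrs
    have h1 : ∀ i, |(φ s.base - φ r.base) i| ≤ C := by
      intro i
      have h2 := (norm_le_pi_norm (castVec (φ s.base - φ r.base)) i).trans (hC r hr s hs)
      have h3 : C₀ * (‖s.base - r.base‖ + 1) ≤ C₀ * (11 * δ + 1) :=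
        mul_le_mul_of_nonneg_left (by linarith) hC₀
      have h4 := h2.trans (h3.trans hCle)
      rw [castVec, Real.norm_eq_abs] at h4
      exact_mod_cast h4
    exact ⟨fun i => (abs_le.1 (h1 i)).1, fun i => (abs_le.1 (h1 i)).2⟩
  have hdiff : ∀ g h, ‖(t h).base - (t g).base - δ • castVec (h - g)‖ ≤ 2 * tileSize v := by
    intro g h
    have h1 := norm_sub_le_of_mem_cell (hgt g)
    have h2 := norm_sub_le_of_mem_cell (hgt h)
    have h3 : (t h).base - (t g).base - δ • castVec (h - g) =
        (δ • castVec g - (t g).base) - (δ • castVec h - (t h).base) := by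
      rw [castVec_sub, smul_sub]; abel
    rw [h3]
    exact (norm_sub_le _ _).trans (by linarith)
  have hdist : ∀ g h, ‖(t h).base - (t g).base‖ ≤ δ * ‖castVec (h - g)‖ + 2 * tileSize v := by
    intro g h
    have h1 := norm_le_norm_add_norm_sub (δ • castVec (h - g)) ((t h).base - (t g).base)
    rw [norm_smul, Real.norm_of_nonneg hδ0, norm_sub_rev (δ • _)] at h1
    linarith [hdiff g h]
  have hbox : ∀ g, ∀ x ∈ σ g, x.1 ∈ Set.Icc (fun _ => -C) (fun _ => C) := by
    intro g x hx
    obtain ⟨r, hr, rfl⟩ := (hσ g x).1 hx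
    exact hmem _ (ht g) r hr.1 ((norm_base_sub_le_of_mem_tilesNear hr).trans (by linarith))
  refine ⟨C, Int.ceil_nonneg (by positivity), fun g => φ (t g).base - φ (t 0).base, σ,
    sub_self _, fun g h hgh => ?_⟩
  have hsub : φ (t h).base - φ (t 0).base - (φ (t g).base - φ (t 0).base) =
      φ (t h).base - φ (t g).base := by abel
  rw [hsub]
  have hproj := hT.tiling.projMap_lift hφ (ht g) (ht h)
  refine ⟨hgh, hmem _ (ht g) _ (ht h) ?_, hbox g, hbox h,
    hT.tiling.isPatch hφ hδ0 (ht g) (hσ g), ?_, ?_⟩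
  · have h1 : ‖castVec (h - g)‖ ≤ 10 := by
      refine (pi_norm_le_iff_of_nonneg (by norm_num)).2 fun i => ?_
      rw [castVec, Real.norm_eq_abs]
      have := abs_le.2 ⟨hgh.1 i, hgh.2 i⟩
      exact_mod_cast this
    have h2 := mul_le_mul_of_nonneg_left h1 hδ0
    linarith [hdist g h]
  · intro x hx y hy
    obtain ⟨r, hr, rfl⟩ := (hσ g x).1 hx
    obtain ⟨s, hs, rfl⟩ := (hσ h y).1 hy
    simp only [hproj]
    rw [hT.tiling.tile_liftTile hφ (ht g) hr.1, hT.tiling.tile_liftTile hφ (ht h) hs.1,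
      Tile.shift_shift, show -(t h).base + ((t h).base - (t g).base) = -(t g).base by abel]
    exact (hT.compatible hr.1 hs.1).shift _
  · intro l hl
    simp only at hl
    simp only [hproj]
    have h1 : castVec (h - g) = Pi.single l (1 : ℝ) := by
      rw [hl, castVec_single]; simp
    refine ⟨by simpa [h1] using hdiff g h, (t h).idx, c (t h), ?_⟩
    -- Origins of neighbouring sites are within `δ + 2 * tileSize v ≤ 2 δ`, so each patch contains
    -- the tile of the next site.
    refine (hσ g _).2 ⟨t h, ⟨ht h, _, (t h).base_mem_carrier, ?_⟩, rfl⟩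
    have h2 : ‖castVec (h - g)‖ ≤ 1 := by
      rw [h1]
      refine (pi_norm_le_iff_of_nonneg zero_le_one).2 fun i => ?_
      by_cases hi : i = l
      · subst hi; simp
      · simp [Pi.single_eq_of_ne hi]
    have h3 := mul_le_mul_of_nonneg_left h2 hδ0
    rw [mem_closedBall_iff_norm]
    linarith [hdist g h]

end patch

/-! ### Conclusion -/

/-- The slope of local rules is computable. -/
theorem AdmitsLocalRules.isComputableSubspace (hd : 0 < d) {V : Submodule ℝ (Fin n → ℝ)}
    (hV : AdmitsLocalRules v V) : IsComputableSubspace V := by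
  obtain ⟨k, R, -, ⟨T, c, hT⟩, w, -, hw⟩ := hV
  have hpl := hw T c hT
  obtain ⟨φ, hφ, hφV⟩ := hpl.lifts
  have hinj := eq_zero_of_projMap_eq_zero hT.tiling hpl.finrank_eq hφ hφV
  obtain ⟨C₀, hC₀, hC₀'⟩ := exists_norm_lift_sub_le hT.tiling hφ hφV hinj
  have hpos := hT.tiling.tileSize_pos hd
  obtain ⟨δ, hδ⟩ : ∃ δ, δ = 4 * d * tileSize v := ⟨_, rfl⟩
  have hd0 : (0 : ℝ) < d := by exact_mod_cast hd
  obtain ⟨C, hC, hne⟩ := hT.exists_isConfig hd hδ hφ hC₀ hC₀'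
  refine isComputableSubspace_of_isConfig hd (finite_siteBox d) (finite_patchTable R δ C)
    single_mem_siteBox hpl.finrank_eq norm_projMap_le hinj hpos.le
    (w := 2 * w) (δ := δ) (η := 2 * tileSize v) (C := C) (by positivity)
    (by rw [hδ]; positivity) (by rw [hδ]; linarith) (by exact_mod_cast hC) hne ?_ ?_ ?_
  · intro ψ σ h g
    obtain ⟨c', hc'⟩ := h.exists_isAllowed hd hδ hpos
    exact h.exists_norm_sub_le hd (hw _ _ hc') g
  · intro ψ σ h r l
    have := h.norm_drift_le 0 (Pi.single l (r : ℤ))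
    rwa [h.1, castVec_zero, map_zero, sub_zero, sub_zero, latticeNorm_single, castVec_single,
      smul_smul, Int.cast_natCast] at this
  · exact fun ψ σ h r l => h.norm_single_le hC r l

end PlanarTiling

theorem mainTheorem2 (n d : ℕ) (hd : 0 < d) (hdn : d < n) (v : Fin n → Fin d → ℝ)
    (hv : ∀ i j, i ≠ j → v i ≠ v j ∧ v i ≠ -v j)
    (T : Set (PlanarTiling.Tile n d)) (V : Submodule ℝ (Fin n → ℝ))
    (hT : PlanarTiling.IsPlanar v T V) (hV : PlanarTiling.AdmitsLocalRules v V) :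
    PlanarTiling.IsComputableSubspace V := hV.isComputableSubspace hd
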